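/- For integers $0\le d\le N$ let $G_{d,N}$ be the Grassmann manifold of all $d$-dimensional linear subspaces of $\mathbb R^N$ and let $\mu_{d,N}$ be its Haar measure, i.e. the rotation invariant Borel probability measure on $G_{d,N}$. For $E\in G_{d,N}$ consider the two $d$-dimensional normed spaces - $X_E=\ell_1^N/E^{\perp}$, where $E^\perp$ is the orthogonal complement of $E$ in $\mathbb R^N$, with the quotient norm; - $Y_E=E$, regarded as a subspace of $\ell_\infty^N$. Given $C>0$, a subspace $F$ of a normed space $X$ is called $C$-complemented if there is a linear projection of $X$ onto $F$ of norm at most $C$, and $F$ is called $C$-isomorphic to $\ell_p^k$ if there is a linear isomorphism $T:\ell_p^k\to F$ with $\|T\|\,\|T^{-1}\|\le C$. There exist universal constants $C>0$, $c>0$ and $\varepsilon\in(0,1)$ such that for all integers $0\le d\le N$: 1. (generic $d$-dimensional quotients of $\ell_1^N$) the set of those $E\in G_{d,N}$ for which it is **not** true that, for $p=1$ or for $p=2$, the space $X_E$ contains a $C$-complemented subspace which is $C$-isomorphic to $\ell_p^k$ for some integer $k\ge c\sqrt d$, has $\mu_{d,N}$-measure at most $\varepsilon^d$; 2. (generic $d$-dimensional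 subspaces of $\ell_\infty^N$) the set of those $E\in G_{d,N}$ for which it is **not** true that, for $p=\infty$ or for $p=2$, the space $Y_E$ contains a $C$-complemented subspace which is $C$-isomorphic to $\ell_p^k$ for some integer $k\ge c\sqrt d$, has $\mu_{d,N}$-measure at most $\varepsilon^d$. -/

import Mathlib

open MeasureTheory

noncomputable section

namespace GenericSubspaces

/-! ### The Grassmann manifold and its Haar measure -/

/-- The orthogonal group `O(N)`, with the topology of entrywise convergence. -/
abbrev O (N : ℕ) := Matrix.orthogonalGroup (Fin N) ℝ

instance (N : ℕ) : MeasurableSpace (O N) := borel _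

instance (N : ℕ) : BorelSpace (O N) := ⟨rfl⟩

instance (N : ℕ) : CompactSpace (O N) := by
  have hcl : IsClosed ((Matrix.orthogonalGroup (Fin N) ℝ : Set (Matrix (Fin N) (Fin N) ℝ))) :=
    isClosed_unitary
  have hK : IsCompact (Set.univ.pi fun _ : Fin N => Set.univ.pi fun _ : Fin N =>
      Metric.closedBall (0 : ℝ) 1) :=
    isCompact_univ_pi fun _ => isCompact_univ_pi fun _ => isCompact_closedBall 0 1
  refine isCompact_iff_compactSpace.1 (IsCompact.of_isClosed_subset hK hcl ?_)
  intro U hU i _ j _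
  have := entry_norm_bound_of_unitary (𝕜 := ℝ) hU i j
  simpa using this

/-- `G_{d,N}`: the set of all `d`-dimensional linear subspaces of `ℝ^N`. -/
def Gr (d N : ℕ) : Type :=
  {E : Submodule ℝ (Fin N → ℝ) // Module.finrank ℝ E = d}

lemma toLin'_injective {N : ℕ} (U : O N) :
    Function.Injective (Matrix.toLin' (U : Matrix (Fin N) (Fin N) ℝ)) := by
  have h : (star (U : Matrix (Fin N) (Fin N) ℝ)) * (U : Matrix (Fin N) (Fin N) ℝ) = 1 :=
    (Matrix.mem_unitaryGroup_iff').1 U.2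
  intro x y hxy
  have := congrArg (Matrix.toLin' (star (U : Matrix (Fin N) (Fin N) ℝ))) hxy
  simpa [Matrix.mulVec_mulVec, h] using this

/-- The action of the orthogonal group on the Grassmann manifold, `(U, E) ↦ U E`. -/
def rotate {d N : ℕ} (U : O N) (E : Gr d N) : Gr d N :=
  ⟨E.1.map (Matrix.toLin' (U : Matrix (Fin N) (Fin N) ℝ)), by
    exact (Submodule.equivMapOfInjective _ (toLin'_injective U) E.1).finrank_eq.symm.trans E.2⟩

/-- The topology of `G_{d,N}` as a homogeneous space of `O(N)`: a set `A` of subspaces is open iff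
`{U ∈ O(N) | U E₀ ∈ A}` is open for every `E₀ ∈ G_{d,N}`. -/
instance (d N : ℕ) : TopologicalSpace (Gr d N) :=
  ⨆ E₀ : Gr d N, TopologicalSpace.coinduced (fun U : O N => rotate U E₀) inferInstance

instance (d N : ℕ) : MeasurableSpace (Gr d N) := borel _

instance (d N : ℕ) : BorelSpace (Gr d N) := ⟨rfl⟩

lemma continuous_rotate {d N : ℕ} (E₀ : Gr d N) : Continuous fun U : O N => rotate U E₀ :=
  continuous_iff_coinduced_le.2
    (le_iSup (fun E₀ : Gr d N =>
      TopologicalSpace.coinduced (fun U : O N => rotate U E₀) inferInstance) E₀)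

/-- The span of the first `d` unit vectors of `ℝ^N`. -/
def coordSubspace {d N : ℕ} (h : d ≤ N) : Gr d N :=
  ⟨Submodule.span ℝ (Set.range fun i : Fin d => Pi.single (Fin.castLE h i) (1 : ℝ)), by
    have hli : LinearIndependent ℝ
        (fun i : Fin d => (Pi.single (Fin.castLE h i) (1 : ℝ) : Fin N → ℝ)) := by
      have := (Pi.basisFun ℝ (Fin N)).linearIndependent.comp (Fin.castLE h)
        (Fin.castLE_injective h)
      simpa [Function.comp_def] using this
    simpa using finrank_span_eq_card hli⟩

/-- `μ_{d,N}`: the Haar (normalized rotation invariant) probability measure on `G_{d,N}`, that is,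
the distribution of `U E₀`, where `U` is distributed according to the normalized Haar measure of
`O(N)` and `E₀` is a fixed `d`-dimensional subspace. -/
def grassmannHaar {d N : ℕ} (h : d ≤ N) : Measure (Gr d N) :=
  (Measure.haarMeasure (⊤ : TopologicalSpace.PositiveCompacts (O N))).map
    fun U => rotate U (coordSubspace h)

instance {d N : ℕ} (h : d ≤ N) : IsProbabilityMeasure (grassmannHaar h) := by
  have : IsProbabilityMeasure
      (Measure.haarMeasure (⊤ : TopologicalSpace.PositiveCompacts (O N))) :=
    ⟨by simpa using Measure.haarMeasure_self (K₀ := (⊤ : TopologicalSpace.PositiveCompacts (O N)))⟩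
  exact Measure.isProbabilityMeasure_map (continuous_rotate _).measurable.aemeasurable

/-! ### Subspaces of `ℓ_∞^N` and quotients of `ℓ_1^N` -/

/-- `ℓ_p^k`, the space `ℝ^k` with the `ℓ_p` norm. -/
abbrev ell (p : ENNReal) (k : ℕ) := PiLp p (fun _ : Fin k => ℝ)

/-- A linear subspace of `ℝ^N`, as a subspace of `ℓ_p^N`. -/
def inEll (p : ENNReal) {N : ℕ} (E : Submodule ℝ (Fin N → ℝ)) : Submodule ℝ (ell p N) :=
  E.map (WithLp.linearEquiv p ℝ (Fin N → ℝ)).symm.toLinearMap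

/-- The orthogonal complement `E^⊥` of `E` in `ℝ^N`, for the canonical inner product. -/
def orthCompl {N : ℕ} (E : Submodule ℝ (Fin N → ℝ)) : Submodule ℝ (Fin N → ℝ) where
  carrier := {x | ∀ y ∈ E, x ⬝ᵥ y = 0}
  add_mem' := fun ha hb y hy => by rw [add_dotProduct, ha y hy, hb y hy, add_zero]
  zero_mem' := fun y _ => zero_dotProduct y
  smul_mem' := fun c x hx y hy => by rw [smul_dotProduct, hx y hy, smul_zero]

/-- The subspace `E` of `ℓ_∞^N`, with the norm of `ℓ_∞^N`. -/
abbrev SubspaceOfEllInfty {d N : ℕ} (E : Gr d N) := inEll ⊤ E.1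

/-- The quotient `ℓ_1^N / E^⊥`, with the quotient norm. It is the `d`-dimensional quotient of
`ℓ_1^N` that corresponds to `E ∈ G_{d,N}`. -/
abbrev QuotientOfEllOne {d N : ℕ} (E : Gr d N) := ell 1 N ⧸ inEll 1 (orthCompl E.1)

/-! ### Isomorphism and complementation constants -/

/-- `X` and `Y` are `C`-isomorphic: there is a linear isomorphism `T : X → Y` with
`‖T‖ ‖T⁻¹‖ ≤ C`. -/
def IsIsomorphicWith (C : ℝ) (X Y : Type*) [SeminormedAddCommGroup X] [NormedSpace ℝ X]
    [SeminormedAddCommGroup Y] [NormedSpace ℝ Y] : Prop :=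
  ∃ T : X ≃L[ℝ] Y, ‖(T : X →L[ℝ] Y)‖ * ‖(T.symm : Y →L[ℝ] X)‖ ≤ C

/-- The subspace `F` of `X` is `C`-complemented: there is a linear projection of `X` onto `F` whose
norm is at most `C`. -/
def IsComplementedWith (C : ℝ) {X : Type*} [SeminormedAddCommGroup X] [NormedSpace ℝ X]
    (F : Submodule ℝ X) : Prop :=
  ∃ P : X →L[ℝ] X, (∀ x, P x ∈ F) ∧ (∀ x ∈ F, P x = x) ∧ ‖P‖ ≤ C

/-- `X` contains a `C`-complemented subspace which is `C`-isomorphic to `ℓ_p^k` for some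
`k ≥ m`. -/
def ContainsComplementedEll (p : ENNReal) [Fact (1 ≤ p)] (C m : ℝ)
    (X : Type*) [SeminormedAddCommGroup X] [NormedSpace ℝ X] : Prop :=
  ∃ (k : ℕ) (F : Submodule ℝ X),
    m ≤ k ∧ IsComplementedWith C F ∧ IsIsomorphicWith C (ell p k) F

end GenericSubspaces

end

/-! The random subspace is modelled by the range of an N × d Gaussian matrix G, whose law is
invariant under O(N) (`grassmannHaar_le_gaussian`). A factorization of the identity of ℓ_p^k through
E ⊆ ℓ_∞^N dualizes to one of ℓ_q^k through ℓ_1^N / E^⊥ with the same constants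
(`containsComplementedEll_of_factorization`), so one construction inside E settles both parts. Let s
= ⌊√d⌋ and k = ⌊s/16⌋; the two alternatives come from comparing N with e^s.

If N ≤ e^s, choose sk rows of G, forming A, in s blocks of k. The columns of G Aᵀ (A Aᵀ)⁻¹ lie in
the range of G and are biorthogonal to the chosen coordinates. A block of them with absolute row
sums at most 4 gives a complemented ℓ_∞^k. If every block fails, a bad row for each block and
suitable signs produce a sum of at least 4s that, given A, is a linear functional of the remaining
rows, with variance at most 9/4 once the smallest singular value of A is at least √d / 6. The
Gaussian tail e^{-32 s² / 9} beats the N^s 2^{sk} choices (`gaussian_notMem_biorthogonalSet_le`).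

If N = e^L with L > s, the maximum of N Gaussians is at least √L / 2 except with doubly
exponentially small probability, so a net argument bounds G below from ℓ_2^d to ℓ_∞^N. Some block of
k columns has all rows of norm at most √(12 L), and G restricted to it gives a complemented ℓ_2^k
(`gaussian_notMem_shortBlockSet_le`).

In both cases one good block among s is enough: failure of all s at once has an exponent of order at
least s², comparable to d, which a single block would not supply for N near e^s. -/

open MeasureTheory

noncomputable section

namespace GenericSubspaces

open ProbabilityTheory

/-! ### Gaussian measure and its orthogonal invariance -/

/-- The standard Gaussian measure on `ℝ^ι`. -/
def gaussian (ι : Type*) [Fintype ι] : Measure (ι → ℝ) := Measure.pi fun _ => gaussianReal 0 1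

instance (ι : Type*) [Fintype ι] : IsProbabilityMeasure (gaussian ι) := by
  unfold gaussian; infer_instance

lemma charFun_gaussian {ι : Type*} [Fintype ι] (t : EuclideanSpace ℝ ι) :
    charFun ((gaussian ι).map (WithLp.toLp 2)) t = Complex.exp (-(t.ofLp ⬝ᵥ t.ofLp : ℝ) / 2) := by
  rw [gaussian, charFun_pi]
  simp_rw [charFun_gaussianReal, ← Complex.exp_sum]
  congr 1
  simp only [dotProduct, Complex.ofReal_sum, neg_div, Finset.sum_div, ← Finset.sum_neg_distrib]
  refine Finset.sum_congr rfl fun i _ => ?_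
  push_cast
  simp
  ring

/-- The image of the standard Gaussian measure under a coisometry is standard Gaussian. -/
lemma gaussian_map_mulVec {ι κ : Type*} [Fintype ι] [Fintype κ] [DecidableEq κ]
    (M : Matrix κ ι ℝ) (hM : M * M.transpose = 1) :
    (gaussian ι).map M.mulVec = gaussian κ := by
  have hmeas : Measurable M.mulVec := (Continuous.matrix_mulVec continuous_const continuous_id).measurable
  have : IsProbabilityMeasure ((gaussian ι).map M.mulVec) :=
    Measure.isProbabilityMeasure_map hmeas.aemeasurable
  refine charFun_eq_pi_iff.1 fun t => ?_
  have h1 := charFun_gaussian t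
  have h2 := charFun_gaussian (WithLp.toLp 2 (M.transpose.mulVec t.ofLp))
  rw [gaussian, charFun_pi] at h1
  rw [h1]
  have h3 : (M.transpose.mulVec t.ofLp) ⬝ᵥ (M.transpose.mulVec t.ofLp) = t.ofLp ⬝ᵥ t.ofLp := by
    rw [Matrix.dotProduct_mulVec, Matrix.vecMul_transpose, Matrix.mulVec_mulVec, hM,
      Matrix.one_mulVec]
  simp only [h3] at h2
  rw [← h2, charFun, charFun, Measure.map_map (by fun_prop) hmeas, integral_map (by fun_prop)
    (by fun_prop), integral_map (by fun_prop) (by fun_prop)]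
  refine integral_congr_ae (Filter.Eventually.of_forall fun x => ?_)
  simp only [Function.comp, EuclideanSpace.inner_eq_star_dotProduct, star_trivial,
    Matrix.dotProduct_mulVec, ← Matrix.mulVec_transpose]

/-- The matrix with entries `ω (i, j)`. -/
def mat {m n : Type*} (ω : m × n → ℝ) : Matrix m n ℝ := Matrix.of fun i j => ω (i, j)

@[simp] lemma mat_apply {m n : Type*} (ω : m × n → ℝ) (i : m) (j : n) : mat ω i j = ω (i, j) := rfl

lemma continuous_mat {m n : Type*} : Continuous (mat : (m × n → ℝ) → Matrix m n ℝ) :=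
  continuous_matrix fun i j => by simpa using continuous_apply (i, j)

/-- Left multiplication by an orthogonal matrix preserves the law of a Gaussian matrix. -/
lemma gaussian_orthogonal_mul {N d : ℕ} (U : O N) (S : Set (Matrix (Fin N) (Fin d) ℝ))
    (hS : MeasurableSet ((mat : (Fin N × Fin d → ℝ) → _) ⁻¹' S)) :
    gaussian (Fin N × Fin d) {ω | (U : Matrix (Fin N) (Fin N) ℝ) * mat ω ∈ S} =
      gaussian (Fin N × Fin d) {ω | mat ω ∈ S} := by
  -- On matrices flattened to vectors, left multiplication by U is the Kronecker product U ⊗ 1,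
  -- again orthogonal.
  set M : Matrix (Fin N × Fin d) (Fin N × Fin d) ℝ :=
    Matrix.kroneckerMap (· * ·) (U : Matrix (Fin N) (Fin N) ℝ) (1 : Matrix (Fin d) (Fin d) ℝ)
  have hU : (U : Matrix (Fin N) (Fin N) ℝ) * (U : Matrix (Fin N) (Fin N) ℝ).transpose = 1 := by
    simpa [Matrix.star_eq_conjTranspose] using (Matrix.mem_unitaryGroup_iff).1 U.2
  have hM : M * M.transpose = 1 := by
    rw [show M.transpose = Matrix.kroneckerMap (· * ·) (U : Matrix (Fin N) (Fin N) ℝ).transpose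
      (1 : Matrix (Fin d) (Fin d) ℝ) by
        ext p q; simp [M, Matrix.one_apply, eq_comm]]
    erw [← Matrix.mul_kronecker_mul]
    rw [hU, one_mul]
    exact Matrix.one_kronecker_one
  have hmat : ∀ ω, mat (M.mulVec ω) = (U : Matrix (Fin N) (Fin N) ℝ) * mat ω := by
    intro ω
    ext i j
    simp only [M, mat_apply, Matrix.mulVec, dotProduct, Matrix.mul_apply,
      Matrix.kroneckerMap_apply, Fintype.sum_prod_type, Matrix.one_apply]
    refine Finset.sum_congr rfl fun x _ => ?_
    simp
  have hmeas : Measurable M.mulVec :=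
    (Continuous.matrix_mulVec continuous_const continuous_id).measurable
  conv_rhs => rw [← gaussian_map_mulVec M hM]
  erw [Measure.map_apply hmeas hS]
  congr 1
  ext ω
  simp [hmat]

/-! ### From Haar measure on the Grassmannian to Gaussian matrices -/

/-- The normalized Haar measure of `O(N)`. -/
abbrev haarO (N : ℕ) : Measure (O N) :=
  Measure.haarMeasure (⊤ : TopologicalSpace.PositiveCompacts (O N))

instance (N : ℕ) : IsProbabilityMeasure (haarO N) :=
  ⟨by simpa using Measure.haarMeasure_self (K₀ := (⊤ : TopologicalSpace.PositiveCompacts (O N)))⟩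

instance (N : ℕ) : SecondCountableTopology (Matrix (Fin N) (Fin N) ℝ) :=
  inferInstanceAs (SecondCountableTopology (Fin N → Fin N → ℝ))

instance (N : ℕ) : SecondCountableTopology (O N) :=
  TopologicalSpace.Subtype.secondCountableTopology _

lemma haarO_map_mul_right {N : ℕ} (V : O N) : (haarO N).map (· * V) = haarO N := by
  have : IsProbabilityMeasure ((haarO N).map (· * V)) :=
    Measure.isProbabilityMeasure_map (by fun_prop)
  have := Measure.haarMeasure_unique ((haarO N).map (· * V)) (⊤ : TopologicalSpace.PositiveCompacts (O N))
  rw [this]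
  simp

lemma rotate_mul {d N : ℕ} (U V : O N) (E : Gr d N) : rotate (U * V) E = rotate U (rotate V E) := by
  apply Subtype.ext
  simp [rotate, Matrix.toLin'_mul, Submodule.map_comp]

/-- Every subspace of dimension at most `d` is contained in a rotation of the coordinate subspace. -/
lemma exists_le_rotate {d N : ℕ} (h : d ≤ N) (F : Submodule ℝ (Fin N → ℝ))
    (hF : Module.finrank ℝ F ≤ d) : ∃ V : O N, F ≤ (rotate V (coordSubspace h)).1 := by
  classical
  let e := (WithLp.linearEquiv 2 ℝ (Fin N → ℝ)).symm
  let F' : Submodule ℝ (EuclideanSpace ℝ (Fin N)) := F.map e.toLinearMap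
  set r := Module.finrank ℝ F'
  have hr : r ≤ d := by
    have : r = Module.finrank ℝ F := LinearEquiv.finrank_map_eq e F
    omega
  let b := stdOrthonormalBasis ℝ F'
  let v : Fin N → EuclideanSpace ℝ (Fin N) := fun i => if hi : (i : ℕ) < r then b ⟨i, hi⟩ else 0
  let s : Set (Fin N) := {i | (i : ℕ) < r}
  have hv : Orthonormal ℝ (s.domRestrict v) := by
    have h1 := b.orthonormal.comp (fun i : s => (⟨i.1, i.2⟩ : Fin r))
      (fun i j hij => by
        apply Subtype.ext; apply Fin.ext; simpa using hij)
    have h2 := h1.comp_linearIsometry F'.subtypeₗᵢ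
    convert h2 using 1
    ext i
    have : (i.1 : ℕ) < r := i.2
    simp [v, this]
  obtain ⟨c, hc⟩ := hv.exists_orthonormalBasis_extension_of_card_eq (by simp)
  let V := (EuclideanSpace.basisFun (Fin N) ℝ).toBasis.toMatrix c
  have hV : V ∈ Matrix.orthogonalGroup (Fin N) ℝ :=
    (EuclideanSpace.basisFun (Fin N) ℝ).toMatrix_orthonormalBasis_mem_orthogonal c
  refine ⟨⟨V, hV⟩, ?_⟩
  have hcol : ∀ i : Fin N, V.mulVec (Pi.single i 1) = (c i).ofLp := by
    intro i
    ext j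
    simp [V, Module.Basis.toMatrix_apply]
  have hF' : F' = Submodule.span ℝ (Set.range fun i : Fin r => (b i : EuclideanSpace ℝ (Fin N))) := by
    have := b.toBasis.span_eq
    have h2 := congrArg (Submodule.map F'.subtype) this
    rw [Submodule.map_span, Submodule.map_top, Submodule.range_subtype, ← Set.range_comp] at h2
    refine h2.symm.trans ?_
    congr 2
  have key : F' ≤ (rotate ⟨V, hV⟩ (coordSubspace h)).1.map e.toLinearMap := by
    rw [hF', Submodule.span_le]
    rintro _ ⟨i, rfl⟩
    have hiN : (i : ℕ) < N := by omega
    refine ⟨(c ⟨i, hiN⟩).ofLp, ⟨Pi.single ⟨i, hiN⟩ 1, ?_, ?_⟩, ?_⟩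
    · exact Submodule.subset_span ⟨⟨i, by omega⟩, rfl⟩
    · simpa using hcol ⟨i, hiN⟩
    · have := hc ⟨i, hiN⟩ (show (i : ℕ) < r from i.2)
      simp [this, v, e]
  intro x hx
  have : e x ∈ F' := ⟨x, hx, rfl⟩
  obtain ⟨y, hy, hxy⟩ := key this
  have : y = x := e.injective hxy
  exact this ▸ hy

/-- If no subspace of `B` contains the range of a matrix from the open set `S`, then the Haar
measure of `B` is at most the probability that a Gaussian matrix is not in `S`. -/
theorem grassmannHaar_le_gaussian {d N : ℕ} (h : d ≤ N) (B : Set (Gr d N))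
    (S : Set (Matrix (Fin N) (Fin d) ℝ)) (hS : IsOpen S)
    (hB : ∀ E ∈ B, ∀ G ∈ S, ¬ LinearMap.range G.mulVecLin ≤ E.1) :
    grassmannHaar h B ≤ gaussian (Fin N × Fin d) {ω | mat ω ∉ S} := by
  -- `B'` is the largest set satisfying the hypothesis. It is closed, so no measurability of `B` is
  -- needed.
  set B' : Set (Gr d N) := {E | ∀ G ∈ S, ¬ LinearMap.range G.mulVecLin ≤ E.1}
  have hmul : ∀ (U : O N) (G : Matrix (Fin N) (Fin d) ℝ) (E : Gr d N),
      LinearMap.range ((U : Matrix (Fin N) (Fin N) ℝ) * G).mulVecLin ≤ (rotate U E).1 ↔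
        LinearMap.range G.mulVecLin ≤ E.1 := by
    intro U G E
    rw [Matrix.mulVecLin_mul, LinearMap.range_comp]
    exact Submodule.map_le_map_iff_of_injective (f := Matrix.toLin' (U : Matrix (Fin N) (Fin N) ℝ))
      (toLin'_injective U) _ _
  have hclosed : IsClosed B' := by
    rw [← isOpen_compl_iff, isOpen_iSup_iff]
    intro E₁
    rw [isOpen_coinduced]
    -- Pulling the witness back by U⁻¹ makes the condition on its range independent of U, leaving a
    -- union of open sets.
    have : (fun U : O N => rotate U E₁) ⁻¹' B'ᶜ =
        ⋃ G : {G : Matrix (Fin N) (Fin d) ℝ // LinearMap.range G.mulVecLin ≤ E₁.1},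
          {U : O N | (U : Matrix (Fin N) (Fin N) ℝ) * G.1 ∈ S} := by
      ext U
      simp only [B', Set.mem_preimage, Set.mem_compl_iff, Set.mem_ofPred_eq, not_forall, not_not,
        Set.mem_iUnion, Subtype.exists, exists_prop]
      constructor
      · rintro ⟨G, hG, hGE⟩
        refine ⟨((U⁻¹ : O N) : Matrix (Fin N) (Fin N) ℝ) * G, ?_, ?_⟩
        · have := (hmul U⁻¹ G (rotate U E₁)).2 hGE
          rw [← rotate_mul, inv_mul_cancel] at this
          convert this
          simp [rotate]
        · rw [← Matrix.mul_assoc, ← Submonoid.coe_mul, mul_inv_cancel]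
          simpa using hG
      · rintro ⟨G, hGE, hG⟩
        exact ⟨_, hG, (hmul U G E₁).2 hGE⟩
    rw [this]
    refine isOpen_iUnion fun G => ?_
    exact hS.preimage (continuous_subtype_val.matrix_mul continuous_const)
  have hBB' : B ⊆ B' := fun E hE G hG => hB E hE G hG
  have hSm : MeasurableSet ((mat : (Fin N × Fin d → ℝ) → _) ⁻¹' Sᶜ) :=
    (hS.isClosed_compl.preimage continuous_mat).measurableSet
  -- For each fixed matrix, some rotation V of the coordinate subspace contains its range, and right
  -- invariance absorbs V. Allowing ranges of smaller dimension avoids any almost sure rank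
  -- statement. Averaging over the matrix and exchanging the integrals then finishes.
  have hpt : ∀ ω : Fin N × Fin d → ℝ, grassmannHaar h B' ≤
      haarO N {U : O N | (U : Matrix (Fin N) (Fin N) ℝ) * mat ω ∈ Sᶜ} := by
    intro ω
    obtain ⟨V, hV⟩ := exists_le_rotate h (LinearMap.range (mat ω).mulVecLin) (by
      simpa using LinearMap.finrank_range_le (mat ω).mulVecLin)
    have hcont := continuous_rotate (N := N) (coordSubspace h)
    have hm : MeasurableSet ((fun U : O N => rotate U (coordSubspace h)) ⁻¹' B') :=
      (hclosed.preimage hcont).measurableSet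
    rw [grassmannHaar, Measure.map_apply hcont.measurable hclosed.measurableSet]
    have hV' : haarO N ((fun U : O N => rotate U (coordSubspace h)) ⁻¹' B') =
        haarO N ((· * V) ⁻¹' ((fun U : O N => rotate U (coordSubspace h)) ⁻¹' B')) := by
      conv_lhs => rw [← haarO_map_mul_right V, Measure.map_apply (by fun_prop) hm]
    rw [hV']
    refine measure_mono fun U hU hUS => ?_
    have hU' : rotate (U * V) (coordSubspace h) ∈ B' := hU
    rw [rotate_mul] at hU'
    exact hU' _ hUS ((hmul _ _ _).2 hV)
  have hcl2 : MeasurableSet {p : (Fin N × Fin d → ℝ) × O N |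
      (p.2 : Matrix (Fin N) (Fin N) ℝ) * mat p.1 ∈ Sᶜ} :=
    (hS.isClosed_compl.preimage ((continuous_subtype_val.comp continuous_snd).matrix_mul
      (continuous_mat.comp continuous_fst))).measurableSet
  calc grassmannHaar h B ≤ grassmannHaar h B' := measure_mono hBB'
    _ = ∫⁻ _, grassmannHaar h B' ∂(gaussian (Fin N × Fin d)) := by simp
    _ ≤ ∫⁻ ω, haarO N {U : O N | (U : Matrix (Fin N) (Fin N) ℝ) * mat ω ∈ Sᶜ}
          ∂(gaussian (Fin N × Fin d)) := lintegral_mono hpt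
    _ = ((gaussian (Fin N × Fin d)).prod (haarO N)) _ := (Measure.prod_apply hcl2).symm
    _ = ∫⁻ U : O N, gaussian (Fin N × Fin d)
          {ω | (U : Matrix (Fin N) (Fin N) ℝ) * mat ω ∈ Sᶜ} ∂(haarO N) :=
        Measure.prod_apply_symm hcl2
    _ = ∫⁻ _ : O N, gaussian (Fin N × Fin d) {ω | mat ω ∈ Sᶜ} ∂(haarO N) := by
        congr 1; ext U; exact gaussian_orthogonal_mul U Sᶜ hSm
    _ = gaussian (Fin N × Fin d) {ω | mat ω ∉ S} := by simp

/-! ### Complemented subspaces from factorizations, and duality -/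

/-- A factorization of the identity of `ℓ_p^k` through `X` gives a complemented copy of `ℓ_p^k`. -/
lemma ContainsComplementedEll.of_factorization {p : ENNReal} [Fact (1 ≤ p)] {k : ℕ} {C a b m : ℝ}
    {X : Type*} [SeminormedAddCommGroup X] [NormedSpace ℝ X] (hm : m ≤ k)
    (A : ell p k →L[ℝ] X) (B : X →L[ℝ] ell p k) (hBA : ∀ u, B (A u) = u)
    (hA : ‖A‖ ≤ a) (hB : ‖B‖ ≤ b) (hC : a * b ≤ C) :
    ContainsComplementedEll p C m X := by
  have hle : ‖A‖ * ‖B‖ ≤ C :=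
    (mul_le_mul hA hB (norm_nonneg _) ((norm_nonneg _).trans hA)).trans hC
  refine ⟨k, LinearMap.range (A : ell p k →ₗ[ℝ] X), hm, ⟨A.comp B, fun x => ⟨B x, rfl⟩, ?_, ?_⟩, ?_⟩
  · rintro _ ⟨u, rfl⟩
    simp [hBA]
  · exact (A.opNorm_comp_le B).trans hle
  · let F := LinearMap.range (A : ell p k →ₗ[ℝ] X)
    let A' : ell p k →L[ℝ] F := A.codRestrict F fun u => ⟨u, rfl⟩
    let B' : F →L[ℝ] ell p k := B.comp F.subtypeL
    refine ⟨ContinuousLinearEquiv.equivOfInverse A' B' (fun u => hBA u) ?_, ?_⟩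
    · rintro ⟨_, ⟨u, rfl⟩⟩
      apply Subtype.ext
      change A (B (A u)) = A u
      rw [hBA]
    · refine le_trans (mul_le_mul ?_ ?_ (norm_nonneg _) (norm_nonneg _)) hle
      · exact ContinuousLinearMap.opNorm_le_bound _ (norm_nonneg _) fun u => A.le_opNorm u
      · exact ContinuousLinearMap.opNorm_le_bound _ (norm_nonneg _) fun u => B.le_opNorm u

lemma mem_inEll {p : ENNReal} {N : ℕ} {E : Submodule ℝ (Fin N → ℝ)} {x : ell p N} :
    x ∈ inEll p E ↔ x.ofLp ∈ E := by
  constructor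
  · rintro ⟨y, hy, rfl⟩
    exact hy
  · intro h
    exact ⟨x.ofLp, h, rfl⟩

/-- A pair of operators `ℓ_p^k → E → ℓ_p^k` with composition the identity, where `E ⊆ ℓ_∞^N`, and
the dual pair `ℓ_q^k → ℓ_1^N / E^⊥ → ℓ_q^k`. -/
lemma containsComplementedEll_of_factorization {p q : ENNReal} [Fact (1 ≤ p)] [Fact (1 ≤ q)]
    (hpq : ∀ (n : ℕ) (u : ell q n) (w : ell p n), |∑ i, u.ofLp i * w.ofLp i| ≤ ‖u‖ * ‖w‖)
    (hqp : ∀ (n : ℕ) (w : ell q n), ∃ u : ell p n, ‖u‖ ≤ 1 ∧ ‖w‖ ≤ ∑ i, w.ofLp i * u.ofLp i)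
    {d N k : ℕ} (E : Gr d N) {C a b m : ℝ} (hm : m ≤ k) (ha : 0 ≤ a) (hb : 0 ≤ b)
    (A : (Fin k → ℝ) →ₗ[ℝ] (Fin N → ℝ)) (hAE : ∀ u, A u ∈ E.1)
    (B : E.1 →ₗ[ℝ] (Fin k → ℝ)) (hBA : ∀ u, B ⟨A u, hAE u⟩ = u)
    (hA : ∀ (u : Fin k → ℝ) j, |A u j| ≤ a * ‖WithLp.toLp p u‖)
    (hB : ∀ w : E.1, ‖WithLp.toLp p (B w)‖ ≤ b * ‖(w : Fin N → ℝ)‖) (hC : a * b ≤ C) :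
    ContainsComplementedEll p C m (SubspaceOfEllInfty E) ∧
      ContainsComplementedEll q C m (QuotientOfEllOne E) := by
  have hAn : ∀ u : Fin k → ℝ, ‖A u‖ ≤ a * ‖WithLp.toLp p u‖ := fun u =>
    (pi_norm_le_iff_of_nonneg (by positivity)).2 fun j => hA u j
  constructor
  · let eN := WithLp.linearEquiv ⊤ ℝ (Fin N → ℝ)
    let ek := WithLp.linearEquiv p ℝ (Fin k → ℝ)
    let A₁ : ell p k →ₗ[ℝ] SubspaceOfEllInfty E :=
      (eN.symm.toLinearMap ∘ₗ A ∘ₗ ek.toLinearMap).codRestrict (inEll ⊤ E.1)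
        fun u => mem_inEll.2 (hAE _)
    let r : SubspaceOfEllInfty E →ₗ[ℝ] E.1 :=
      (eN.toLinearMap ∘ₗ (inEll ⊤ E.1).subtype).codRestrict E.1 fun w => mem_inEll.1 w.2
    let B₁ : SubspaceOfEllInfty E →ₗ[ℝ] ell p k := ek.symm.toLinearMap ∘ₗ B ∘ₗ r
    have hnorm : ∀ w : ell ⊤ N, ‖w‖ = ‖w.ofLp‖ := fun w => by
      rw [← PiLp.norm_toLp]
    refine ContainsComplementedEll.of_factorization hm
      (A₁.mkContinuous a fun u => ?_) (B₁.mkContinuous b fun w => ?_) (fun u => ?_)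
      (LinearMap.mkContinuous_norm_le _ ha _) (LinearMap.mkContinuous_norm_le _ hb _) hC
    · rw [Submodule.coe_norm, hnorm]
      exact hAn _
    · rw [Submodule.coe_norm, hnorm]
      exact hB (r w)
    · exact congrArg (WithLp.toLp p) (hBA u.ofLp)
  · let e1 := WithLp.linearEquiv 1 ℝ (Fin N → ℝ)
    let eq := WithLp.linearEquiv q ℝ (Fin k → ℝ)
    -- The transpose of B needs B on all of ℝ^N; any linear extension serves, since two of them
    -- change β u only by an element of E^⊥.
    choose g hg using fun i : Fin k => LinearMap.exists_extend (LinearMap.proj i ∘ₗ B)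
    have hg' : ∀ i (w : E.1), g i w = B w i := fun i w => LinearMap.congr_fun (hg i) w
    let β : (Fin k → ℝ) →ₗ[ℝ] (Fin N → ℝ) :=
      LinearMap.pi fun j => ∑ i, g i (Pi.single j 1) • LinearMap.proj i
    have hsum : ∀ (f : (Fin N → ℝ) →ₗ[ℝ] ℝ) w, ∑ j, f (Pi.single j 1) * w j = f w := by
      intro f w
      conv_rhs => rw [← Finset.univ_sum_single w, map_sum]
      refine Finset.sum_congr rfl fun j _ => ?_
      rw [mul_comm, ← smul_eq_mul, ← map_smul, ← Pi.single_smul]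
      simp
    have hβ : ∀ u (w : E.1), β u ⬝ᵥ (w : Fin N → ℝ) = ∑ i, u i * B w i := by
      intro u w
      simp only [β, dotProduct, LinearMap.pi_apply, LinearMap.sum_apply, LinearMap.smul_apply,
        LinearMap.proj_apply, smul_eq_mul, Finset.sum_mul]
      rw [Finset.sum_comm]
      refine Finset.sum_congr rfl fun i _ => ?_
      rw [← hg' i w, ← hsum (g i) w, Finset.mul_sum]
      exact Finset.sum_congr rfl fun j _ => by ring
    let A₂ : ell q k →ₗ[ℝ] QuotientOfEllOne E :=
      (inEll 1 (orthCompl E.1)).mkQ ∘ₗ e1.symm.toLinearMap ∘ₗ β ∘ₗ eq.toLinearMap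
    let D : ell 1 N →ₗ[ℝ] ell q k := eq.symm.toLinearMap ∘ₗ
      (LinearMap.pi fun i => ∑ j, A (Pi.single i 1) j • LinearMap.proj j) ∘ₗ e1.toLinearMap
    have hD : ∀ z i, (D z).ofLp i = z.ofLp ⬝ᵥ A (Pi.single i 1) := by
      intro z i
      simp [D, dotProduct, e1, eq, mul_comm]
    have hDker : inEll 1 (orthCompl E.1) ≤ LinearMap.ker D := by
      intro z hz
      rw [LinearMap.mem_ker]
      ext i
      rw [hD]
      exact mem_inEll.1 hz _ (hAE _)
    let B₂ : QuotientOfEllOne E →ₗ[ℝ] ell q k := (inEll 1 (orthCompl E.1)).liftQ D hDker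
    have hDn : ∀ z, ‖D z‖ ≤ a * ‖z‖ := by
      intro z
      obtain ⟨u, hu, hle⟩ := hqp k (D z)
      refine hle.trans ?_
      have hz : ∑ i, (D z).ofLp i * u.ofLp i = z.ofLp ⬝ᵥ A u.ofLp := by
        simp_rw [hD]
        conv_rhs => rw [← Finset.univ_sum_single u.ofLp,
          map_sum, dotProduct_sum]
        refine Finset.sum_congr rfl fun i _ => ?_
        rw [mul_comm, ← smul_eq_mul, ← dotProduct_smul, ← map_smul, ← Pi.single_smul]
        simp
      rw [hz, PiLp.norm_eq_of_L1, Finset.mul_sum]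
      refine Finset.sum_le_sum fun j _ => ?_
      refine (le_abs_self _).trans ?_
      rw [abs_mul, mul_comm, Real.norm_eq_abs]
      refine mul_le_mul_of_nonneg_right ((hA _ j).trans ?_) (abs_nonneg _)
      exact mul_le_of_le_one_right ha hu
    refine ContainsComplementedEll.of_factorization hm (a := b) (b := a)
      (A₂.mkContinuous b fun u => ?_) (B₂.mkContinuous a fun x => ?_) (fun u => ?_)
      (LinearMap.mkContinuous_norm_le _ hb _) (LinearMap.mkContinuous_norm_le _ ha _)
      (by rwa [mul_comm])
    · let φ₀ : E.1 →ₗ[ℝ] ℝ := (∑ i, u.ofLp i • LinearMap.proj i) ∘ₗ B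
      have hφ₀ : ∀ w, φ₀ w = ∑ i, u.ofLp i * B w i := fun w => by simp [φ₀]
      -- The extension g carries no norm control. Hahn–Banach gives another representative z of the
      -- class of β u, with ℓ_1 norm at most b‖u‖.
      let φ : StrongDual ℝ E.1 := φ₀.mkContinuous (b * ‖u‖) fun w => by
        rw [hφ₀, Real.norm_eq_abs]
        calc _ ≤ ‖u‖ * ‖WithLp.toLp p (B w)‖ := hpq k u (WithLp.toLp p (B w))
          _ ≤ ‖u‖ * (b * ‖(w : Fin N → ℝ)‖) := by gcongr; exact hB w
          _ = b * ‖u‖ * ‖w‖ := by rw [Submodule.coe_norm]; ring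
      obtain ⟨f, hf, hfn⟩ := exists_extension_norm_eq E.1 φ
      have hfb : ‖f‖ ≤ b * ‖u‖ := hfn ▸ LinearMap.mkContinuous_norm_le _ (by positivity) _
      let z : ell 1 N := WithLp.toLp 1 fun j => f (Pi.single j 1)
      have hz : ‖z‖ ≤ b * ‖u‖ := by
        refine le_trans ?_ hfb
        rw [PiLp.norm_eq_of_L1]
        have h1 := hsum (f : (Fin N → ℝ) →ₗ[ℝ] ℝ) fun j => SignType.sign (f (Pi.single j 1))
        -- The sign vector norms f: the ℓ_1 norm of its coefficients is its value at a vector of sup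
        -- norm at most 1.
        have h2 : ‖fun j => ((SignType.sign (f (Pi.single j 1)) : SignType) : ℝ)‖ ≤ 1 := by
          refine (pi_norm_le_iff_of_nonneg zero_le_one).2 fun j => ?_
          rcases (SignType.sign (f (Pi.single j 1))).trichotomy with h | h | h <;> simp [h]
        calc ∑ j, ‖z.ofLp j‖ = f fun j => SignType.sign (f (Pi.single j 1)) := by
              refine Eq.trans (Finset.sum_congr rfl fun j _ => ?_) h1
              simp [z]
          _ ≤ ‖f‖ * 1 := (le_abs_self _).trans (f.le_opNorm_of_le h2)
          _ = ‖f‖ := mul_one _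
      have hmk : A₂ u = Submodule.Quotient.mk z := by
        change Submodule.Quotient.mk _ = _
        rw [Submodule.Quotient.eq, mem_inEll]
        intro y hy
        have h3 : z.ofLp ⬝ᵥ y = ∑ i, u.ofLp i * B ⟨y, hy⟩ i := by
          rw [← hφ₀]
          exact (hsum (f : (Fin N → ℝ) →ₗ[ℝ] ℝ) y).trans (hf ⟨y, hy⟩)
        have h4 := hβ u.ofLp ⟨y, hy⟩
        change (β u.ofLp - z.ofLp) ⬝ᵥ y = 0
        rw [sub_dotProduct, h3, h4, sub_self]
      rw [hmk]
      exact (Submodule.Quotient.norm_mk_le _ z).trans hz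
    · refine le_of_forall_pos_le_add fun δ hδ => ?_
      have hδ' : 0 < δ / (a + 1) := by positivity
      obtain ⟨z, rfl, hz⟩ := Submodule.Quotient.norm_mk_lt x hδ'
      calc ‖D z‖ ≤ a * ‖z‖ := hDn z
        _ ≤ a * (‖(Submodule.Quotient.mk z : QuotientOfEllOne E)‖ + δ / (a + 1)) := by gcongr
        _ = a * ‖(Submodule.Quotient.mk z : QuotientOfEllOne E)‖ + a / (a + 1) * δ := by ring
        _ ≤ a * ‖(Submodule.Quotient.mk z : QuotientOfEllOne E)‖ + δ := by
          gcongr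
          exact mul_le_of_le_one_left hδ.le ((div_le_one (by positivity)).2 (by linarith))
    · change B₂ (A₂ u) = u
      ext i
      change (D (e1.symm (β u.ofLp))).ofLp i = _
      rw [hD]
      change β u.ofLp ⬝ᵥ _ = _
      rw [hβ u.ofLp ⟨_, hAE (Pi.single i 1)⟩, hBA]
      simp [Pi.single_apply]

/-- Vectors of `E` that are biorthogonal to `k` coordinates and have bounded absolute row sums span
complemented copies of `ℓ_∞^k` in `E ⊆ ℓ_∞^N`, and dually of `ℓ_1^k` in `ℓ_1^N / E^⊥`. -/
lemma containsComplementedEll_top_one {d N k : ℕ} (E : Gr d N) {C m : ℝ} (hm : m ≤ k) (hC : 0 ≤ C)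
    (i : Fin k → Fin N) (v : Fin k → Fin N → ℝ) (hv : ∀ l, v l ∈ E.1)
    (hvi : ∀ l l', v l (i l') = if l = l' then 1 else 0) (hvC : ∀ j, ∑ l, |v l j| ≤ C) :
    ContainsComplementedEll ⊤ C m (SubspaceOfEllInfty E) ∧
      ContainsComplementedEll 1 C m (QuotientOfEllOne E) := by
  refine containsComplementedEll_of_factorization (a := C) (b := 1) ?_ ?_ E hm hC zero_le_one
    (Fintype.linearCombination ℝ v) ?_ (LinearMap.pi fun l => LinearMap.proj (i l) ∘ₗ E.1.subtype)
    ?_ ?_ ?_ (by simp)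
  · intro n u w
    rw [PiLp.norm_eq_of_L1, Finset.sum_mul]
    refine (Finset.abs_sum_le_sum_abs _ _).trans (Finset.sum_le_sum fun l _ => ?_)
    rw [abs_mul]
    exact mul_le_mul_of_nonneg_left (PiLp.norm_apply_le w l) (abs_nonneg _)
  · intro n w
    refine ⟨WithLp.toLp ⊤ fun l => SignType.sign (w.ofLp l), ?_, ?_⟩
    · rw [PiLp.norm_toLp]
      refine (pi_norm_le_iff_of_nonneg zero_le_one).2 fun j => ?_
      rcases (SignType.sign (w.ofLp j)).trichotomy with h | h | h <;> simp [h]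
    · rw [PiLp.norm_eq_of_L1]
      exact Finset.sum_le_sum fun l _ => by simp
  · intro u
    rw [Fintype.linearCombination_apply]
    exact Submodule.sum_mem _ fun l _ => E.1.smul_mem _ (hv l)
  · intro u
    ext l
    simp [Fintype.linearCombination_apply, hvi]
  · intro u j
    simp only [Fintype.linearCombination_apply, Finset.sum_apply, Pi.smul_apply, smul_eq_mul]
    refine (Finset.abs_sum_le_sum_abs _ _).trans ?_
    refine le_trans ?_ (mul_le_mul_of_nonneg_right (hvC j) (norm_nonneg _))
    rw [Finset.sum_mul]
    refine Finset.sum_le_sum fun l _ => ?_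
    rw [abs_mul, mul_comm]
    exact mul_le_mul_of_nonneg_left (PiLp.norm_apply_le (WithLp.toLp ⊤ u) l) (abs_nonneg _)
  · intro w
    rw [one_mul, PiLp.norm_toLp]
    exact (pi_norm_le_iff_of_nonneg (norm_nonneg _)).2 fun l => norm_le_pi_norm (w : Fin N → ℝ) (i l)

/-- A matrix bounded below from `ℓ_2^d` to `ℓ_∞^N`, with `k` columns whose rows are short, gives
complemented copies of `ℓ_2^k` in its range and in the dual quotient. -/
lemma containsComplementedEll_two {d N k : ℕ} (E : Gr d N) {C m α b : ℝ} (hm : m ≤ k) (hα : 0 < α)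
    (hb : 0 ≤ b) (hC : b / α ≤ C) (G : Matrix (Fin N) (Fin d) ℝ)
    (hG : LinearMap.range G.mulVecLin ≤ E.1) (hlow : ∀ x, α * √(x ⬝ᵥ x) ≤ ‖G.mulVec x‖)
    (e : Fin k → Fin d) (he : Function.Injective e) (hup : ∀ j, ∑ l, G j (e l) ^ 2 ≤ b ^ 2) :
    ContainsComplementedEll 2 C m (SubspaceOfEllInfty E) ∧
      ContainsComplementedEll 2 C m (QuotientOfEllOne E) := by
  let T : (Fin d → ℝ) →ₗ[ℝ] E.1 := G.mulVecLin.codRestrict E.1 fun x => hG ⟨x, rfl⟩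
  have hTinj : Function.Injective T := by
    rw [← LinearMap.ker_eq_bot, LinearMap.ker_eq_bot']
    intro x hx
    have h1 : G.mulVec x = 0 := congrArg Subtype.val hx
    have h2 := hlow x
    rw [h1, norm_zero] at h2
    have h3 : √(x ⬝ᵥ x) ≤ 0 := by
      by_contra! h
      have := mul_pos hα h
      linarith
    have h4 : x ⬝ᵥ x ≤ 0 := Real.sqrt_eq_zero'.1 (le_antisymm h3 (Real.sqrt_nonneg _))
    exact dotProduct_self_eq_zero.1 (le_antisymm h4 (Finset.sum_nonneg fun i _ => mul_self_nonneg _))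
  -- The lower bound makes G injective, so by dimension its range is all of E. The left inverse used
  -- below reads k coordinates of G⁻¹ and has norm at most 1/α.
  let T' : (Fin d → ℝ) ≃ₗ[ℝ] E.1 := LinearEquiv.ofBijective T
    ⟨hTinj, (LinearMap.injective_iff_surjective_of_finrank_eq_finrank (by simp [E.2])).1 hTinj⟩
  let ext : (Fin k → ℝ) →ₗ[ℝ] (Fin d → ℝ) :=
    Fintype.linearCombination ℝ fun l => Pi.single (e l) (1 : ℝ)
  have hext : ∀ u l, ext u (e l) = u l := fun u l => by
    simp [ext, Fintype.linearCombination_apply, Pi.single_apply, he.eq_iff]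
  have hGext : ∀ u j, G.mulVec (ext u) j = ∑ l, u l * G j (e l) := fun u j => by
    simp only [ext, Fintype.linearCombination_apply]
    rw [Matrix.mulVec_sum, Finset.sum_apply]
    simp [Matrix.mulVec_smul]
  refine containsComplementedEll_of_factorization (a := b) (b := α⁻¹) ?_ ?_ E hm hb (by positivity)
    (E.1.subtype ∘ₗ T ∘ₗ ext) (fun u => (T (ext u)).2)
    (LinearMap.pi (fun l => LinearMap.proj (e l)) ∘ₗ T'.symm.toLinearMap) ?_ ?_ ?_ hC
  · intro n u w
    have := abs_real_inner_le_norm u w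
    rw [PiLp.inner_apply] at this
    simpa [mul_comm] using this
  · intro n w
    by_cases hw : w = 0
    · exact ⟨0, by simp, by simp [hw]⟩
    · refine ⟨(‖w‖)⁻¹ • w, ?_, ?_⟩
      · rw [norm_smul, norm_inv, norm_norm, inv_mul_cancel₀ (norm_ne_zero_iff.2 hw)]
      · have h1 := EuclideanSpace.real_norm_sq_eq w
        have h2 : ∑ i, w.ofLp i * ((‖w‖)⁻¹ • w).ofLp i = ‖w‖⁻¹ * ‖w‖ ^ 2 := by
          rw [h1, Finset.mul_sum]
          exact Finset.sum_congr rfl fun i _ => by simp; ring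
        rw [h2]
        field_simp
        exact le_rfl
  · intro u
    have : (⟨(E.1.subtype ∘ₗ T ∘ₗ ext) u, (T (ext u)).2⟩ : E.1) = T' (ext u) := rfl
    ext l
    rw [this]
    simp [hext]
  · intro u j
    change |G.mulVec (ext u) j| ≤ _
    rw [hGext]
    have h1 := abs_real_inner_le_norm (WithLp.toLp 2 u) (WithLp.toLp 2 fun l => G j (e l))
    rw [PiLp.inner_apply] at h1
    have h2 : ‖(WithLp.toLp 2 fun l => G j (e l) : EuclideanSpace ℝ (Fin k))‖ ≤ b := by
      refine abs_le_of_sq_le_sq' ?_ hb |>.2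
      rw [EuclideanSpace.real_norm_sq_eq]
      exact hup j
    have h3 : |∑ l, u l * G j (e l)| ≤ ‖WithLp.toLp 2 u‖ *
        ‖(WithLp.toLp 2 fun l => G j (e l) : EuclideanSpace ℝ (Fin k))‖ := by
      simpa [mul_comm] using h1
    exact h3.trans (by rw [mul_comm]; gcongr)
  · intro w
    obtain ⟨x, rfl⟩ := T'.surjective w
    have h1 := hlow x
    have h2 : ‖(WithLp.toLp 2 fun l => x (e l) : EuclideanSpace ℝ (Fin k))‖ ≤ √(x ⬝ᵥ x) := by
      refine Real.le_sqrt_of_sq_le ?_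
      rw [EuclideanSpace.real_norm_sq_eq]
      refine le_trans (le_of_eq ?_) (Finset.sum_le_sum_of_subset_of_nonneg
        (Finset.subset_univ (Finset.univ.map ⟨e, he⟩)) fun i _ _ => mul_self_nonneg (x i))
      rw [Finset.sum_map]
      exact Finset.sum_congr rfl fun l _ => sq _
    change ‖(WithLp.toLp 2 fun l => T'.symm (T' x) (e l) : EuclideanSpace ℝ (Fin k))‖ ≤
      α⁻¹ * ‖G.mulVec x‖
    rw [LinearEquiv.symm_apply_apply, ← div_eq_inv_mul, le_div_iff₀ hα, mul_comm]
    exact (mul_le_mul_of_nonneg_left h2 hα.le).trans h1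

/-! ### Gaussian marginals and tail estimates -/

lemma gaussian_map_mat_mulVec {m n : Type*} [Fintype m] [Fintype n] (u : n → ℝ) (hu : u ⬝ᵥ u = 1) :
    (gaussian (m × n)).map (fun ω => (mat ω).mulVec u) = gaussian m := by
  classical
  let M : Matrix m (m × n) ℝ := Matrix.of fun i p => if i = p.1 then u p.2 else 0
  have hM : M * M.transpose = 1 := by
    ext i j
    simp only [M, Matrix.mul_apply, Fintype.sum_prod_type, Matrix.of_apply, Matrix.transpose_apply,
      Matrix.one_apply, ite_mul, mul_ite, zero_mul, mul_zero]
    rw [Finset.sum_eq_single i (by intro b _ hb; simp [hb.symm]) (by simp)]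
    by_cases hij : i = j
    · simpa [hij, dotProduct] using hu
    · simp [hij, Ne.symm hij]
  rw [← gaussian_map_mulVec M hM]
  congr 1
  ext ω i
  simp only [M, Matrix.mulVec, dotProduct, Fintype.sum_prod_type, Matrix.of_apply, ite_mul, zero_mul,
    mat_apply]
  rw [Finset.sum_eq_single i (by intro b _ hb; simp [hb.symm]) (by simp)]
  simp [mul_comm]

lemma gaussian_map_vecMul_mat {m n : Type*} [Fintype m] [Fintype n] (u : m → ℝ) (hu : u ⬝ᵥ u = 1) :
    (gaussian (m × n)).map (fun ω => Matrix.vecMul u (mat ω)) = gaussian n := by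
  classical
  let M : Matrix n (m × n) ℝ := Matrix.of fun i p => if i = p.2 then u p.1 else 0
  have hM : M * M.transpose = 1 := by
    ext i j
    simp only [M, Matrix.mul_apply, Fintype.sum_prod_type, Matrix.of_apply, Matrix.transpose_apply,
      Matrix.one_apply, ite_mul, mul_ite, zero_mul, mul_zero]
    by_cases hij : i = j
    · subst hij
      simpa [dotProduct] using hu
    · simp [hij]
  rw [← gaussian_map_mulVec M hM]
  congr 1
  ext ω i
  simp [M, Matrix.mulVec, Matrix.vecMul, dotProduct, Fintype.sum_prod_type]

lemma gaussian_map_comp {ι κ : Type*} [Fintype ι] [Fintype κ] (f : κ → ι)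
    (hf : Function.Injective f) : (gaussian ι).map (fun ω => ω ∘ f) = gaussian κ := by
  classical
  let M : Matrix κ ι ℝ := Matrix.of fun k i => if f k = i then 1 else 0
  have hM : M * M.transpose = 1 := by
    ext i j
    simp [M, Matrix.mul_apply, Matrix.one_apply, hf.eq_iff, eq_comm]
  rw [← gaussian_map_mulVec M hM]
  congr 1
  ext ω i
  simp [M, Matrix.mulVec, dotProduct]

/-- Replacing part of the coordinates by those of an independent copy preserves the Gaussian
measure. -/
lemma gaussian_map_piecewise {ι : Type*} [Fintype ι] (P : ι → Prop) [DecidablePred P] :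
    ((gaussian ι).prod (gaussian ι)).map (fun z i => if P i then z.1 i else z.2 i) =
      gaussian ι := by
  refine (Measure.pi_eq fun s hs => ?_).symm
  have hm : Measurable fun (z : (ι → ℝ) × (ι → ℝ)) i => if P i then z.1 i else z.2 i := by
    refine measurable_pi_lambda _ fun i => ?_
    split_ifs <;> fun_prop
  rw [Measure.map_apply hm (MeasurableSet.univ_pi hs)]
  have : (fun (z : (ι → ℝ) × (ι → ℝ)) i => if P i then z.1 i else z.2 i) ⁻¹' Set.univ.pi s =
      (Set.univ.pi fun i => if P i then s i else Set.univ) ×ˢ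
        (Set.univ.pi fun i => if P i then Set.univ else s i) := by
    ext z
    simp only [Set.mem_preimage, Set.mem_pi, Set.mem_univ, true_imp_iff, Set.mem_prod,
      ← forall_and]
    refine forall_congr' fun i => ?_
    split_ifs <;> simp
  rw [this, Measure.prod_prod, gaussian, Measure.pi_pi, Measure.pi_pi, ← Finset.prod_mul_distrib]
  refine Finset.prod_congr rfl fun i _ => ?_
  split_ifs <;> simp

lemma integral_exp_mul_sq_gaussianReal {c : ℝ} (hc : c < 1 / 2) :
    ∫ x, Real.exp (c * x ^ 2) ∂(gaussianReal 0 1) = √(1 / (1 - 2 * c)) := by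
  rw [integral_gaussianReal_eq_integral_smul one_ne_zero]
  have h : ∀ x : ℝ, gaussianPDFReal 0 1 x • Real.exp (c * x ^ 2) =
      (√(2 * Real.pi))⁻¹ * Real.exp (-(1 / 2 - c) * x ^ 2) := by
    intro x
    rw [gaussianPDFReal, smul_eq_mul, mul_assoc, ← Real.exp_add]
    simp only [sub_zero, NNReal.coe_one, mul_one]
    congr 2
    ring
  simp_rw [h]
  rw [integral_const_mul, integral_gaussian, ← Real.sqrt_inv, ← Real.sqrt_mul (by positivity)]
  congr 1
  have : (1 : ℝ) / 2 - c ≠ 0 := by linarith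
  have : (1 : ℝ) - 2 * c ≠ 0 := by linarith
  field_simp

lemma integral_exp_sum_sq_gaussian (ι : Type*) [Fintype ι] {c : ℝ} (hc : c < 1 / 2) :
    ∫ ω, Real.exp (c * ∑ i, ω i ^ 2) ∂(gaussian ι) = √(1 / (1 - 2 * c)) ^ Fintype.card ι := by
  simp_rw [Finset.mul_sum, Real.exp_sum]
  rw [gaussian, integral_fintype_prod_eq_prod (fun _ x => Real.exp (c * x ^ 2))]
  simp [integral_exp_mul_sq_gaussianReal hc]

lemma integrable_exp_sum_sq_gaussian (ι : Type*) [Fintype ι] {c : ℝ} (hc : c < 1 / 2) :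
    Integrable (fun ω : ι → ℝ => Real.exp (c * ∑ i, ω i ^ 2)) (gaussian ι) := by
  refine .of_integral_ne_zero ?_
  rw [integral_exp_sum_sq_gaussian ι hc]
  have : 0 < 1 - 2 * c := by linarith
  positivity

lemma exp_seven_div_ten : (2 : ℝ) ≤ Real.exp (7 / 10) := by
  rw [← Real.log_le_iff_le_exp (by norm_num)]
  linarith [Real.log_two_lt_d9]

/-- Upper tail of the squared norm of a Gaussian vector. -/
lemma gaussian_sum_sq_ge_le (ι : Type*) [Fintype ι] (t : ℝ) :
    (gaussian ι).real {ω | t ≤ ∑ i, ω i ^ 2} ≤ Real.exp (7 / 20 * Fintype.card ι - t / 4) := by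
  -- Chernoff with parameter 1/4: each coordinate contributes a factor √2 ≤ e^{7/20}.
  have h := measure_ge_le_exp_mul_mgf (μ := gaussian ι) (X := fun ω => ∑ i, ω i ^ 2) (t := 1 / 4) t
    (by norm_num) (integrable_exp_sum_sq_gaussian ι (by norm_num))
  refine h.trans ?_
  rw [mgf, integral_exp_sum_sq_gaussian ι (by norm_num),
    show 7 / 20 * (Fintype.card ι : ℝ) - t / 4 = -(1 / 4) * t + 7 / 20 * Fintype.card ι by ring,
    Real.exp_add]
  have h2 : √(1 / (1 - 2 * (1 / 4))) ≤ Real.exp (7 / 20) := by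
    rw [Real.sqrt_le_left (by positivity), ← Real.exp_nat_mul]
    norm_num
    exact exp_seven_div_ten
  have h3 : Real.exp (7 / 20 * Fintype.card ι) = Real.exp (7 / 20) ^ Fintype.card ι := by
    rw [← Real.exp_nat_mul, mul_comm]
  rw [h3]
  gcongr

/-- Lower tail of the squared norm of a Gaussian vector. -/
lemma gaussian_sum_sq_le_le (ι : Type*) [Fintype ι] :
    (gaussian ι).real {ω | ∑ i, ω i ^ 2 ≤ Fintype.card ι / 16} ≤
      Real.exp (-(3 / 4) * Fintype.card ι) := by
  -- Chernoff with parameter 4: each coordinate contributes 1/3 ≤ e^{-1}, and the threshold costs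
  -- only e^{1/4}.
  have h := measure_ge_le_exp_mul_mgf (μ := gaussian ι) (X := fun ω => -∑ i, ω i ^ 2) (t := 4)
    (-(Fintype.card ι / 16 : ℝ)) (by norm_num)
    (by simpa using integrable_exp_sum_sq_gaussian ι (c := -4) (by norm_num))
  simp only [neg_le_neg_iff] at h
  refine h.trans ?_
  have hi := integral_exp_sum_sq_gaussian ι (c := -4) (by norm_num)
  have hm : mgf (fun ω : ι → ℝ => -∑ i, ω i ^ 2) (gaussian ι) 4 = (1 / 3) ^ Fintype.card ι := by
    rw [mgf]
    simp only [mul_neg, ← neg_mul]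
    rw [hi]
    congr 1
    rw [Real.sqrt_eq_iff_eq_sq] <;> norm_num
  have h2 : (1 / 3 : ℝ) ≤ Real.exp (-1) := by
    rw [Real.exp_neg, one_div]
    exact inv_anti₀ (by positivity) (by linarith [Real.exp_one_lt_d9])
  rw [hm]
  calc _ ≤ Real.exp (-4 * (-(Fintype.card ι / 16 : ℝ))) * Real.exp (-1) ^ Fintype.card ι := by
        gcongr
    _ = _ := by
        rw [← Real.exp_nat_mul, ← Real.exp_add]
        ring_nf

/-- Tail of a linear functional of a Gaussian vector. -/
lemma gaussian_dotProduct_ge_le {ι : Type*} [Fintype ι] (a : ι → ℝ) {V T : ℝ} (hV : 0 < V)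
    (ha : a ⬝ᵥ a ≤ V) (hT : 0 ≤ T) :
    (gaussian ι).real {ω | T ≤ a ⬝ᵥ ω} ≤ Real.exp (-T ^ 2 / (2 * V)) := by
  have hint : ∀ t : ℝ, ∫ ω, Real.exp (t * (a ⬝ᵥ ω)) ∂(gaussian ι) =
      Real.exp (t ^ 2 * (a ⬝ᵥ a) / 2) := by
    intro t
    simp_rw [dotProduct, Finset.mul_sum, Real.exp_sum, ← mul_assoc]
    rw [gaussian, integral_fintype_prod_eq_prod (fun i x => Real.exp (t * a i * x))]
    have := fun i => mgf_gaussianReal (p := gaussianReal 0 1) (X := id) (μ := 0) (v := 1)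
      (by simp) (t * a i)
    simp only [mgf, id] at this
    simp_rw [this]
    rw [← Real.exp_sum, Finset.sum_div]
    congr 1
    refine Finset.sum_congr rfl fun i _ => ?_
    simp
    ring
  have hTV : 0 ≤ T / V := by positivity
  refine (measure_ge_le_exp_mul_mgf (μ := gaussian ι) (X := fun ω => a ⬝ᵥ ω) (t := T / V) T hTV
    (.of_integral_ne_zero (by rw [hint]; positivity))).trans ?_
  rw [mgf, hint, ← Real.exp_add]
  refine Real.exp_le_exp.2 ?_
  have h1 : (T / V) ^ 2 * (a ⬝ᵥ a) / 2 ≤ (T / V) ^ 2 * V / 2 := by gcongr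
  have h2 : -(T / V) * T + (T / V) ^ 2 * V / 2 = -T ^ 2 / (2 * V) := by field_simp; ring
  linarith

/-- The complement contains (a, a + 1], where the density is at least its value at a + 1 and 1/√(2π)
≥ 1/3; then 1 - x ≤ e^{-x}. -/
lemma gaussianReal_abs_le_le {a : ℝ} (ha : 0 ≤ a) :
    (gaussianReal 0 1).real {x | |x| ≤ a} ≤ Real.exp (-(1 / 3 * Real.exp (-(a + 1) ^ 2 / 2))) := by
  have h1 : 1 / 3 * Real.exp (-(a + 1) ^ 2 / 2) ≤ (gaussianReal 0 1).real (Set.Ioc a (a + 1)) := by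
    rw [measureReal_def, gaussianReal_apply_eq_integral _ one_ne_zero, ENNReal.toReal_ofReal
      (integral_nonneg fun x => gaussianPDFReal_nonneg _ _ _)]
    have h2 : ∫ x in Set.Ioc a (a + 1), (1 / 3 * Real.exp (-(a + 1) ^ 2 / 2)) ≤
        ∫ x in Set.Ioc a (a + 1), gaussianPDFReal 0 1 x := by
      refine setIntegral_mono_on (integrableOn_const measure_Ioc_lt_top.ne) (integrable_gaussianPDFReal 0 1).integrableOn
        measurableSet_Ioc fun x hx => ?_
      rw [gaussianPDFReal]
      refine mul_le_mul ?_ ?_ (by positivity) (by positivity)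
      · rw [one_div]
        refine inv_anti₀ (by positivity) (Real.sqrt_le_iff.2 ⟨by norm_num, ?_⟩)
        norm_num
        linarith [Real.pi_lt_d2]
      · refine Real.exp_le_exp.2 ?_
        simp only [sub_zero, NNReal.coe_one, mul_one]
        have : x ^ 2 ≤ (a + 1) ^ 2 := by
          have := hx.1; have := hx.2
          gcongr
          linarith
        linarith
    simpa using h2
  have h3 : (gaussianReal 0 1).real {x | |x| ≤ a} + (gaussianReal 0 1).real (Set.Ioc a (a + 1)) ≤ 1 := by
    rw [← measureReal_union _ measurableSet_Ioc]
    · exact measureReal_le_one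
    · rw [Set.disjoint_left]
      intro x hx hx2
      have := hx2.1
      have := (abs_le.1 (show |x| ≤ a from hx)).2
      linarith
  have := Real.add_one_le_exp (-(1 / 3 * Real.exp (-(a + 1) ^ 2 / 2)))
  linarith

/-- Small ball estimate for the maximum of independent Gaussian variables. -/
lemma gaussian_forall_abs_le_le (ι : Type*) [Fintype ι] {a : ℝ} (ha : 0 ≤ a) :
    (gaussian ι).real {ω | ∀ i, |ω i| ≤ a} ≤
      Real.exp (-(Fintype.card ι / 3 * Real.exp (-(a + 1) ^ 2 / 2))) := by
  have : {ω : ι → ℝ | ∀ i, |ω i| ≤ a} = Set.univ.pi fun _ => {x | |x| ≤ a} := by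
    ext; simp
  rw [this, gaussian, measureReal_def, Measure.pi_pi, ENNReal.toReal_prod, Finset.prod_const,
    Finset.card_univ]
  refine (pow_le_pow_left₀ ENNReal.toReal_nonneg (gaussianReal_abs_le_le ha) _).trans (le_of_eq ?_)
  rw [← Real.exp_nat_mul]
  ring_nf

/-! ### Nets and the smallest singular value -/

/-- Volumetric bound: a separated subset of the unit ball is not large. -/
lemma card_le_of_separated {E : Type*} [NormedAddCommGroup E] [NormedSpace ℝ E]
    [FiniteDimensional ℝ E] (s : Finset E) {δ : ℝ} (hδ : 0 < δ) (hδ1 : δ ≤ 1)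
    (hs : ∀ c ∈ s, ‖c‖ ≤ 1) (h : ∀ c ∈ s, ∀ d ∈ s, c ≠ d → δ < ‖c - d‖) :
    (s.card : ℝ) ≤ (3 / δ) ^ Module.finrank ℝ E := by
  borelize E
  let μ : Measure E := Measure.addHaar
  let r : ℝ := δ / 2
  let ρ : ℝ := 3 / 2
  have hr : 0 < r := by positivity
  set A := ⋃ c ∈ s, Metric.ball c r
  have D : (s : Set E).Pairwise (Function.onFun Disjoint fun c => Metric.ball c r) := by
    rintro c hc d hd hcd
    apply Metric.ball_disjoint_ball
    rw [dist_eq_norm]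
    have := h c hc d hd hcd
    simp only [r]
    linarith
  have hAs : A ⊆ Metric.ball (0 : E) ρ := by
    refine Set.iUnion₂_subset fun x hx => ?_
    apply Metric.ball_subset_ball'
    rw [dist_zero_right]
    have := hs x hx
    simp only [r, ρ]
    linarith
  have I : (s.card : ENNReal) * ENNReal.ofReal (r ^ Module.finrank ℝ E) * μ (Metric.ball 0 1) ≤
      ENNReal.ofReal (ρ ^ Module.finrank ℝ E) * μ (Metric.ball 0 1) :=
    calc (s.card : ENNReal) * ENNReal.ofReal (r ^ Module.finrank ℝ E) * μ (Metric.ball 0 1) = μ A := by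
          rw [measure_biUnion_finset D fun c _ => measurableSet_ball]
          simp only [μ.addHaar_ball_of_pos _ hr]
          simp only [Finset.sum_const, nsmul_eq_mul, mul_assoc]
      _ ≤ μ (Metric.ball (0 : E) ρ) := measure_mono hAs
      _ = ENNReal.ofReal (ρ ^ Module.finrank ℝ E) * μ (Metric.ball 0 1) := by
          simp only [μ.addHaar_ball_of_pos _ (show (0 : ℝ) < ρ by norm_num [ρ])]
  have J : (s.card : ENNReal) * ENNReal.ofReal (r ^ Module.finrank ℝ E) ≤
      ENNReal.ofReal (ρ ^ Module.finrank ℝ E) := by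
    rwa [ENNReal.mul_le_mul_iff_left (Metric.measure_ball_pos _ _ zero_lt_one).ne'
      measure_ball_lt_top.ne] at I
  have K : (s.card : ℝ) * r ^ Module.finrank ℝ E ≤ ρ ^ Module.finrank ℝ E := by
    have := ENNReal.toReal_le_of_le_ofReal (by positivity) J
    simpa [ENNReal.toReal_mul, hr.le] using this
  have : (3 / δ : ℝ) = ρ / r := by simp only [ρ, r]; field_simp
  rw [this, div_pow, le_div_iff₀ (by positivity)]
  exact K

/-- The unit sphere of `ℓ_2^ι` has a `δ`-net of cardinality at most `(3/δ)^|ι|`. -/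
lemma exists_net (ι : Type*) [Fintype ι] {δ : ℝ} (hδ : 0 < δ) (hδ1 : δ ≤ 1) :
    ∃ s : Finset (ι → ℝ), (∀ v ∈ s, v ⬝ᵥ v = 1) ∧
      (∀ u : ι → ℝ, u ⬝ᵥ u = 1 → ∃ v ∈ s, (u - v) ⬝ᵥ (u - v) ≤ δ ^ 2) ∧
      (s.card : ℝ) ≤ (3 / δ) ^ Fintype.card ι := by
  classical
  let E := EuclideanSpace ℝ ι
  let Q : Finset E → Prop := fun s => (∀ c ∈ s, ‖c‖ = 1) ∧
    ∀ c ∈ s, ∀ d ∈ s, c ≠ d → δ < ‖c - d‖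
  have hbound : ∀ s, Q s → s.card ≤ ⌊(3 / δ) ^ Fintype.card ι⌋₊ := by
    intro s hs
    refine Nat.le_floor ?_
    have := card_le_of_separated s hδ hδ1 (fun c hc => (hs.1 c hc).le) hs.2
    simpa [E] using this
  -- A separated set of largest cardinality exists by the volumetric bound, and maximality makes it
  -- a net.
  obtain ⟨s, hs, hmax⟩ : ∃ s, Q s ∧ ∀ t, Q t → t.card ≤ s.card := by
    let R : ℕ → Prop := fun n => ∃ s, Q s ∧ s.card = n
    have hR : R 0 := ⟨∅, by simp [Q], rfl⟩
    have h1 := Nat.findGreatest_spec (P := R) (Nat.zero_le ⌊(3 / δ) ^ Fintype.card ι⌋₊) hR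
    obtain ⟨s, hs, hcard⟩ := h1
    refine ⟨s, hs, fun t ht => ?_⟩
    rw [hcard]
    exact Nat.le_findGreatest (hbound t ht) ⟨t, ht, rfl⟩
  have hsq : ∀ x : E, ‖x‖ ^ 2 = x.ofLp ⬝ᵥ x.ofLp := fun x => by
    rw [EuclideanSpace.real_norm_sq_eq]
    simp [dotProduct, sq]
  refine ⟨s.image WithLp.ofLp, ?_, ?_, ?_⟩
  · intro v hv
    obtain ⟨c, hc, rfl⟩ := Finset.mem_image.1 hv
    rw [← hsq, hs.1 c hc, one_pow]
  · intro u hu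
    let x : E := WithLp.toLp 2 u
    have hx : ‖x‖ = 1 := by
      have h1 := hsq x
      rw [show x.ofLp ⬝ᵥ x.ofLp = 1 from hu] at h1
      have h0 := norm_nonneg x
      nlinarith
    have : ∃ c ∈ s, ‖x - c‖ ≤ δ := by
      by_contra! hcon
      have hxs : x ∉ s := fun hx => by
        have := hcon x hx
        rw [sub_self, norm_zero] at this
        linarith
      have hQ : Q (insert x s) := by
        refine ⟨?_, ?_⟩
        · intro c hc
          rcases Finset.mem_insert.1 hc with rfl | hc
          · exact hx
          · exact hs.1 c hc
        · intro c hc d hd hcd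
          rcases Finset.mem_insert.1 hc with rfl | hc <;>
            rcases Finset.mem_insert.1 hd with rfl | hd
          · exact absurd rfl hcd
          · exact hcon d hd
          · rw [norm_sub_rev]; exact hcon c hc
          · exact hs.2 c hc d hd hcd
      have := hmax _ hQ
      rw [Finset.card_insert_of_notMem hxs] at this
      omega
    obtain ⟨c, hc, hle⟩ := this
    refine ⟨c.ofLp, Finset.mem_image_of_mem _ hc, ?_⟩
    have := hsq (x - c)
    change _ = (u - c.ofLp) ⬝ᵥ (u - c.ofLp) at this
    rw [← this]
    gcongr
  · refine le_trans (Nat.cast_le.2 Finset.card_image_le) ?_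
    exact (Nat.le_floor_iff (by positivity)).1 (hbound s hs)

lemma norm_toLp_sq {ι : Type*} [Fintype ι] (x : ι → ℝ) :
    ‖(WithLp.toLp 2 x : EuclideanSpace ℝ ι)‖ ^ 2 = x ⬝ᵥ x := by
  rw [EuclideanSpace.real_norm_sq_eq]
  simp [dotProduct, sq]

/-- A lower bound for a linear map on the unit sphere from two-sided bounds on a net. -/
lemma le_norm_of_net {E F : Type*} [NormedAddCommGroup E] [NormedSpace ℝ E] [NormedAddCommGroup F]
    [NormedSpace ℝ F] (T : E →L[ℝ] F) (s : Set E) {r : ℝ} (hr : 0 ≤ r)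
    (hs : ∀ u : E, ‖u‖ = 1 → ∃ v ∈ s, ‖u - v‖ ≤ 1 / 40)
    (hlow : ∀ v ∈ s, r / 4 ≤ ‖T v‖) (hup : ∀ v ∈ s, ‖T v‖ ≤ 3 * r) (u : E) :
    r / 6 * ‖u‖ ≤ ‖T u‖ := by
  -- Self-improvement: this gives ‖T‖ ≤ (40/13) r, so passing to the net costs at most r/13, and 1/4
  -- - 1/13 > 1/6.
  have h1 : ‖T‖ ≤ 3 * r + ‖T‖ * (1 / 40) := by
    refine T.opNorm_le_of_unit_norm (by positivity) fun u hu => ?_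
    obtain ⟨v, hv, huv⟩ := hs u hu
    calc ‖T u‖ = ‖T v + T (u - v)‖ := by rw [← map_add, add_sub_cancel]
      _ ≤ ‖T v‖ + ‖T (u - v)‖ := norm_add_le _ _
      _ ≤ _ := add_le_add (hup v hv) (T.le_opNorm_of_le huv)
  have h2 : ∀ u : E, ‖u‖ = 1 → r / 6 ≤ ‖T u‖ := by
    intro u hu
    obtain ⟨v, hv, huv⟩ := hs u hu
    have h3 : ‖T v‖ ≤ ‖T u‖ + ‖T (u - v)‖ := by
      calc ‖T v‖ = ‖T u - T (u - v)‖ := by rw [← map_sub, sub_sub_cancel]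
        _ ≤ _ := norm_sub_le _ _
    have h4 : ‖T (u - v)‖ ≤ ‖T‖ * (1 / 40) := T.le_opNorm_of_le huv
    have h5 := hlow v hv
    linarith
  by_cases hu : u = 0
  · simp [hu]
  · have hu' : 0 < ‖u‖ := norm_pos_iff.2 hu
    have h3 := h2 (‖u‖⁻¹ • u) (by rw [norm_smul, norm_inv, norm_norm, inv_mul_cancel₀ hu'.ne'])
    rw [map_smul, norm_smul, norm_inv, norm_norm, ← div_eq_inv_mul, le_div_iff₀ hu'] at h3
    exact h3

/-- The smallest singular value of a Gaussian matrix with few rows. -/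
lemma gaussian_exists_small_vecMul_le (κ n : Type*) [Fintype κ] [Fintype n] :
    (gaussian (κ × n)).real {ω | ¬ ∀ u : κ → ℝ, (Fintype.card n : ℝ) / 36 * (u ⬝ᵥ u) ≤
        Matrix.vecMul u (mat ω) ⬝ᵥ Matrix.vecMul u (mat ω)} ≤
      2 * Real.exp (5 * Fintype.card κ - 3 / 4 * Fintype.card n) := by
  classical
  set D : ℝ := (Fintype.card n : ℝ)
  have hD : 0 ≤ D := by positivity
  obtain ⟨s, hs1, hs2, hs3⟩ := exists_net κ (δ := 1 / 40) (by norm_num) (by norm_num)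
  have hmeas : ∀ v : κ → ℝ, Measurable fun ω : κ × n → ℝ => Matrix.vecMul v (mat ω) := fun v =>
    (continuous_const.matrix_vecMul continuous_mat).measurable
  have hsub : {ω : κ × n → ℝ | ¬ ∀ u : κ → ℝ, D / 36 * (u ⬝ᵥ u) ≤
        Matrix.vecMul u (mat ω) ⬝ᵥ Matrix.vecMul u (mat ω)} ⊆
      ⋃ v ∈ s, ((fun ω => Matrix.vecMul v (mat ω)) ⁻¹' {x | ∑ i, x i ^ 2 ≤ D / 16} ∪
        (fun ω => Matrix.vecMul v (mat ω)) ⁻¹' {x | 9 * D ≤ ∑ i, x i ^ 2}) := by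
    intro ω hω
    by_contra hcon
    apply hω
    simp only [Set.mem_iUnion, Set.mem_union, Set.mem_preimage, not_exists, not_or] at hcon
    intro u
    let T : EuclideanSpace ℝ κ →L[ℝ] EuclideanSpace ℝ n :=
      ((WithLp.linearEquiv 2 ℝ (n → ℝ)).symm.toLinearMap ∘ₗ (mat ω).vecMulLinear ∘ₗ
        (WithLp.linearEquiv 2 ℝ (κ → ℝ)).toLinearMap).toContinuousLinearMap
    have hT : ∀ x : κ → ℝ, T (WithLp.toLp 2 x) = WithLp.toLp 2 (Matrix.vecMul x (mat ω)) :=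
      fun x => rfl
    have hsq : ∀ x : n → ℝ, ∑ i, x i ^ 2 = x ⬝ᵥ x := fun x => by simp [dotProduct, sq]
    have := le_norm_of_net T (WithLp.toLp 2 '' (s : Set (κ → ℝ))) (Real.sqrt_nonneg D) ?_ ?_ ?_
      (WithLp.toLp 2 u)
    · have h2 := pow_le_pow_left₀ (by positivity) this 2
      rw [mul_pow, hT, norm_toLp_sq, norm_toLp_sq, div_pow, Real.sq_sqrt hD] at h2
      norm_num at h2
      linarith
    · intro x hx
      obtain ⟨v, hv, hle⟩ := hs2 x.ofLp (by
        rw [← norm_toLp_sq]; change ‖x‖ ^ 2 = 1; rw [hx, one_pow])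
      refine ⟨_, ⟨v, hv, rfl⟩, ?_⟩
      rw [← norm_toLp_sq] at hle
      exact abs_le_of_sq_le_sq' hle (by norm_num) |>.2
    · rintro _ ⟨v, hv, rfl⟩
      have h1 : ¬ (∑ i, Matrix.vecMul v (mat ω) i ^ 2 ≤ D / 16) := (hcon v hv).1
      rw [not_le] at h1
      rw [hsq] at h1
      refine abs_le_of_sq_le_sq' ?_ (norm_nonneg _) |>.2
      rw [hT, norm_toLp_sq, div_pow, Real.sq_sqrt hD]
      norm_num
      exact h1.le
    · rintro _ ⟨v, hv, rfl⟩
      have h1 : ¬ (9 * D ≤ ∑ i, Matrix.vecMul v (mat ω) i ^ 2) := (hcon v hv).2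
      rw [not_le] at h1
      rw [hsq] at h1
      refine abs_le_of_sq_le_sq' ?_ (by positivity) |>.2
      rw [hT, norm_toLp_sq, mul_pow, Real.sq_sqrt hD]
      norm_num
      exact h1.le
  refine (measureReal_mono hsub (measure_ne_top _ _)).trans ((measureReal_biUnion_finset_le _ _).trans ?_)
  have hone : ∀ v ∈ s, (gaussian (κ × n)).real
      ((fun ω => Matrix.vecMul v (mat ω)) ⁻¹' {x | ∑ i, x i ^ 2 ≤ D / 16} ∪
        (fun ω => Matrix.vecMul v (mat ω)) ⁻¹' {x | 9 * D ≤ ∑ i, x i ^ 2}) ≤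
      2 * Real.exp (-(3 / 4) * D) := by
    intro v hv
    refine (measureReal_union_le _ _).trans ?_
    rw [← map_measureReal_apply (hmeas v) (measurableSet_le (by fun_prop) (by fun_prop)),
      ← map_measureReal_apply (hmeas v) (measurableSet_le (by fun_prop) (by fun_prop)),
      gaussian_map_vecMul_mat v (hs1 v hv)]
    have h1 := gaussian_sum_sq_le_le n
    have h2 := gaussian_sum_sq_ge_le n (9 * D)
    have h3 : Real.exp (7 / 20 * D - 9 * D / 4) ≤ Real.exp (-(3 / 4) * D) :=
      Real.exp_le_exp.2 (by linarith)
    linarith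
  refine (Finset.sum_le_sum hone).trans ?_
  rw [Finset.sum_const, nsmul_eq_mul]
  -- The net has at most 120 points per dimension, and 120 ≤ 2.7⁵ ≤ e⁵.
  have h5 : (3 / (1 / 40) : ℝ) ^ Fintype.card κ ≤ Real.exp (5 * Fintype.card κ) := by
    rw [mul_comm, Real.exp_nat_mul]
    refine pow_le_pow_left₀ (by norm_num) ?_ _
    have h6 : (2.7 : ℝ) ≤ Real.exp 1 := by linarith [Real.exp_one_gt_d9]
    have h7 : Real.exp 5 = Real.exp 1 ^ 5 := by rw [← Real.exp_nat_mul]; norm_num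
    rw [h7]
    refine le_trans (by norm_num) (pow_le_pow_left₀ (by norm_num) h6 5)
  calc (s.card : ℝ) * (2 * Real.exp (-(3 / 4) * D)) ≤
      Real.exp (5 * Fintype.card κ) * (2 * Real.exp (-(3 / 4) * D)) := by
        gcongr
        exact hs3.trans h5
    _ = _ := by rw [mul_left_comm, ← Real.exp_add]; ring_nf

/-! ### Small N: biorthogonal systems -/

/-- A conditional form of the tail bound for linear functionals of a Gaussian vector: the
coefficients may depend on the coordinates on which they vanish. -/
lemma gaussian_conditional_tail {ι : Type*} [Fintype ι] (P : ι → Prop) [DecidablePred P]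
    (S : Set (ι → ℝ)) (hS : MeasurableSet S) (a : (ι → ℝ) → (ι → ℝ))
    (ha : Measurable fun ω => a ω ⬝ᵥ ω) (ha0 : ∀ ω i, P i → a ω i = 0)
    (hdep : ∀ ω ω', (∀ i, P i → ω i = ω' i) → (ω ∈ S ↔ ω' ∈ S) ∧ a ω = a ω')
    {V T : ℝ} (hV : 0 < V) (hT : 0 ≤ T) (haV : ∀ ω ∈ S, a ω ⬝ᵥ a ω ≤ V) :
    (gaussian ι).real {ω | ω ∈ S ∧ T ≤ a ω ⬝ᵥ ω} ≤ Real.exp (-T ^ 2 / (2 * V)) := by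
  have hm : Measurable fun (z : (ι → ℝ) × (ι → ℝ)) i => if P i then z.1 i else z.2 i := by
    refine measurable_pi_lambda _ fun i => ?_
    split_ifs <;> fun_prop
  have hB : MeasurableSet {ω | ω ∈ S ∧ T ≤ a ω ⬝ᵥ ω} :=
    hS.inter (measurableSet_le measurable_const ha)
  rw [measureReal_def]
  refine ENNReal.toReal_le_of_le_ofReal (Real.exp_nonneg _) ?_
  -- The coordinates outside P are resampled independently; S and the coefficients do not notice, so
  -- for each fixed first copy the unconditional tail applies.
  conv_lhs => rw [← gaussian_map_piecewise P]
  rw [Measure.map_apply hm hB, Measure.prod_apply (hm hB)]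
  refine (lintegral_mono (g := fun _ => ENNReal.ofReal (Real.exp (-T ^ 2 / (2 * V)))) ?_).trans
    (by simp)
  intro x
  by_cases hx : x ∈ S
  · have h1 := gaussian_dotProduct_ge_le (a x) hV (haV x hx) hT
    refine le_trans (measure_mono ?_) (ENNReal.le_ofReal_iff_toReal_le (measure_ne_top _ _)
      (Real.exp_nonneg _) |>.2 h1)
    rintro y ⟨-, hy⟩
    have h2 := (hdep x (fun i => if P i then x i else y i) fun i hi => by simp [hi]).2
    change T ≤ a x ⬝ᵥ y
    convert hy using 1
    rw [← h2]
    refine Finset.sum_congr rfl fun i _ => ?_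
    by_cases hi : P i
    · simp [ha0 x i hi]
    · simp [hi]
  · have : Prod.mk x ⁻¹' ((fun (z : (ι → ℝ) × (ι → ℝ)) i => if P i then z.1 i else z.2 i) ⁻¹'
        {ω | ω ∈ S ∧ T ≤ a ω ⬝ᵥ ω}) = ∅ := by
      ext y
      simp only [Set.mem_preimage, Set.mem_empty_iff_false, iff_false]
      rintro ⟨hy, -⟩
      exact hx ((hdep x (fun i => if P i then x i else y i) fun i hi => by simp [hi]).1.2 hy)
    beta_reduce
    rw [this]
    simp

/-- The matrices `G` with a biorthogonal system to the rows `e (l, ·)` that spans a copy of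
`ℓ_∞^k` with constant `4`, for some `l`. -/
def biorthogonalSet {N d m k : ℕ} (e : Fin m × Fin k → Fin N) : Set (Matrix (Fin N) (Fin d) ℝ) :=
  {G | ∃ l, ∀ j, ∑ i, |(G * (G.submatrix e id).transpose *
    ((G.submatrix e id) * (G.submatrix e id).transpose).adjugate) j (l, i)| <
      4 * |((G.submatrix e id) * (G.submatrix e id).transpose).det|}

/-- Clearing the denominator det(A Aᵀ) by the adjugate leaves a strict inequality between continuous
functions of G, defined also where A Aᵀ is singular. -/
lemma isOpen_biorthogonalSet {N d m k : ℕ} (e : Fin m × Fin k → Fin N) :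
    IsOpen (biorthogonalSet (d := d) e) := by
  have h1 : Continuous fun G : Matrix (Fin N) (Fin d) ℝ => G.submatrix e id :=
    continuous_id.matrix_submatrix _ _
  have h2 := h1.matrix_mul h1.matrix_transpose
  have h3 := (continuous_id.matrix_mul h1.matrix_transpose).matrix_mul h2.matrix_adjugate
  rw [biorthogonalSet, Set.ofPred_exists]
  refine isOpen_iUnion fun l => ?_
  rw [Set.ofPred_forall]
  refine isOpen_iInter_of_finite fun j => ?_
  refine isOpen_lt (continuous_finsetSum _ fun i _ => (h3.matrix_elem j (l, i)).abs)
    (continuous_const.mul h2.matrix_det.abs)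

lemma det_mul_transpose_ne_zero {κ n : Type*} [Fintype κ] [Fintype n] [DecidableEq κ]
    (A : Matrix κ n ℝ) {r : ℝ} (hr : 0 < r)
    (hA : ∀ u, r * (u ⬝ᵥ u) ≤ Matrix.vecMul u A ⬝ᵥ Matrix.vecMul u A) :
    (A * A.transpose).det ≠ 0 := by
  intro h
  obtain ⟨v, hv, h0⟩ := Matrix.exists_mulVec_eq_zero_iff.2 h
  have h1 : Matrix.vecMul v A ⬝ᵥ Matrix.vecMul v A = v ⬝ᵥ (A * A.transpose).mulVec v := by
    rw [← Matrix.mulVec_mulVec, Matrix.dotProduct_mulVec, Matrix.mulVec_transpose]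
  have h2 := hA v
  rw [h1, h0, dotProduct_zero] at h2
  have h3 : v ⬝ᵥ v ≤ 0 := by
    by_contra! h4
    have := mul_pos hr h4
    linarith
  exact hv (dotProduct_self_eq_zero.1
    (le_antisymm h3 (Finset.sum_nonneg fun i _ => mul_self_nonneg _)))

lemma submatrix_mul_transpose_mul_adjugate {κ : Type*} [Fintype κ] [DecidableEq κ] {N d : ℕ}
    (e : κ → Fin N) (G : Matrix (Fin N) (Fin d) ℝ) :
    (G * (G.submatrix e id).transpose *
      ((G.submatrix e id) * (G.submatrix e id).transpose).adjugate).submatrix e id =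
      ((G.submatrix e id) * (G.submatrix e id).transpose).det • (1 : Matrix κ κ ℝ) := by
  rw [Matrix.submatrix_mul _ _ _ id _ Function.bijective_id,
    Matrix.submatrix_mul _ _ _ id _ Function.bijective_id, ← Matrix.mul_adjugate]
  simp

/-- The vectors are the columns of G Aᵀ (A Aᵀ)⁻¹ belonging to the good block. For k > 0 the strict
inequality itself rules out a zero determinant. -/
lemma exists_biorthogonal {N d m k : ℕ} (e : Fin m × Fin k → Fin N)
    {G : Matrix (Fin N) (Fin d) ℝ} (hG : G ∈ biorthogonalSet e) :
    ∃ (i : Fin k → Fin N) (v : Fin k → Fin N → ℝ), (∀ l, v l ∈ LinearMap.range G.mulVecLin) ∧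
      (∀ l l', v l (i l') = if l = l' then 1 else 0) ∧ ∀ j, ∑ l, |v l j| ≤ 4 := by
  obtain ⟨l, hl⟩ := hG
  set A := G.submatrix e id
  set D := (A * A.transpose).det
  by_cases hN : D = 0
  · rcases Nat.eq_zero_or_pos k with rfl | hk
    · exact ⟨Fin.elim0, Fin.elim0, fun l => l.elim0, fun l => l.elim0, fun j => by simp⟩
    · have h1 := hl (e (l, ⟨0, hk⟩))
      rw [hN, abs_zero, mul_zero] at h1
      exact absurd h1 (not_lt.2 (Finset.sum_nonneg fun i _ => abs_nonneg _))
  · set Q := G * A.transpose * (A * A.transpose).adjugate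
    refine ⟨fun i => e (l, i), fun i j => D⁻¹ * Q j (l, i), fun i => ?_, fun i i' => ?_, fun j => ?_⟩
    · refine ⟨D⁻¹ • (A.transpose * (A * A.transpose).adjugate).col (l, i), ?_⟩
      ext j
      simp [Q, Matrix.mul_assoc, Matrix.mul_apply, Matrix.mulVec, dotProduct]
    · have h1 : Q.submatrix e id = D • 1 := submatrix_mul_transpose_mul_adjugate e G
      have h2 := congrFun (congrFun h1 (l, i')) (l, i)
      simp only [Matrix.submatrix_apply, id, Matrix.smul_apply, Matrix.one_apply, Prod.mk.injEq,
        true_and, smul_eq_mul] at h2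
      change D⁻¹ * Q (e (l, i')) (l, i) = _
      rw [h2, ← mul_assoc, inv_mul_cancel₀ hN, one_mul]
      simp [eq_comm]
    · simp_rw [abs_mul, ← Finset.mul_sum, abs_inv]
      rw [← div_eq_inv_mul, div_le_iff₀ (abs_pos.2 hN)]
      exact (hl j).le

/-- The coefficients of the linear functional that bounds the row sums outside the range of `e`. -/
def blockCoeff {N d m k : ℕ} (e : Fin m × Fin k → Fin N) (j : Fin m → Fin N)
    (s : Fin m × Fin k → Bool) (ω : Fin N × Fin d → ℝ) (p : Fin N × Fin d) : ℝ :=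
  open Classical in
  let A := (mat ω).submatrix e id
  if p.1 ∈ Set.range e then 0 else
    (A * A.transpose).det⁻¹ * (A.transpose * (A * A.transpose).adjugate).mulVec
      (fun q => if j q.1 = p.1 then (if s q then 1 else -1) else 0) p.2

/-- The norm of `Aᵀ (A Aᵀ)⁻¹` is controlled by the smallest singular value of `A`. -/
lemma pinv_dotProduct_le {κ n : Type*} [Fintype κ] [Fintype n] [DecidableEq κ]
    (A : Matrix κ n ℝ) {r : ℝ} (hr : 0 < r)
    (hA : ∀ u, r * (u ⬝ᵥ u) ≤ Matrix.vecMul u A ⬝ᵥ Matrix.vecMul u A) (σ : κ → ℝ) :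
    ((A * A.transpose).det⁻¹ • (A.transpose * (A * A.transpose).adjugate).mulVec σ) ⬝ᵥ
      ((A * A.transpose).det⁻¹ • (A.transpose * (A * A.transpose).adjugate).mulVec σ) ≤
      r⁻¹ * (σ ⬝ᵥ σ) := by
  have hD := det_mul_transpose_ne_zero A hr hA
  set M := A * A.transpose
  set w := M.det⁻¹ • M.adjugate.mulVec σ
  have hMw : M.mulVec w = σ := by
    simp only [w]
    rw [Matrix.mulVec_smul, Matrix.mulVec_mulVec, Matrix.mul_adjugate, Matrix.smul_mulVec,
      Matrix.one_mulVec, smul_smul, inv_mul_cancel₀ hD, one_smul]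
  have hy : M.det⁻¹ • (A.transpose * M.adjugate).mulVec σ = Matrix.vecMul w A := by
    simp only [w]
    rw [← Matrix.mulVec_transpose, Matrix.mulVec_smul, Matrix.mulVec_mulVec]
  have hyy : Matrix.vecMul w A ⬝ᵥ Matrix.vecMul w A = w ⬝ᵥ σ := by
    conv_rhs => rw [← hMw]
    rw [← Matrix.mulVec_mulVec, Matrix.dotProduct_mulVec, Matrix.mulVec_transpose]
  rw [hy]
  have h1 := hA w
  rw [hyy] at h1 ⊢
  -- Combined with r |w|² ≤ w·σ, the square yields r (w·σ) ≤ |σ|².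
  have h2 : 0 ≤ (r • w - σ) ⬝ᵥ (r • w - σ) := Finset.sum_nonneg fun i _ => mul_self_nonneg _
  have h3 : (r • w - σ) ⬝ᵥ (r • w - σ) = r ^ 2 * (w ⬝ᵥ w) - 2 * r * (w ⬝ᵥ σ) + σ ⬝ᵥ σ := by
    simp only [sub_dotProduct, dotProduct_sub, smul_dotProduct, dotProduct_smul, smul_eq_mul,
      dotProduct_comm σ w]
    ring
  rw [h3] at h2
  rw [← div_eq_inv_mul, le_div_iff₀ hr]
  nlinarith

/-- Linearizes the failure of all blocks: pairing with ω recovers the signed sum of the entries of G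
Aᵀ (A Aᵀ)⁻¹ in the selected rows, while the coefficients depend on A only. -/
lemma blockCoeff_dotProduct {N d m k : ℕ} (e : Fin m × Fin k → Fin N) (j : Fin m → Fin N)
    (hj : ∀ l, j l ∉ Set.range e) (s : Fin m × Fin k → Bool) (ω : Fin N × Fin d → ℝ) :
    blockCoeff e j s ω ⬝ᵥ ω = ∑ q : Fin m × Fin k,
      ((mat ω).submatrix e id * ((mat ω).submatrix e id).transpose).det⁻¹ *
        (mat ω * ((mat ω).submatrix e id).transpose *
          ((mat ω).submatrix e id * ((mat ω).submatrix e id).transpose).adjugate) (j q.1) q *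
        (if s q then 1 else -1) := by
  classical
  set A := (mat ω).submatrix e id
  set D := (A * A.transpose).det
  set R := A.transpose * (A * A.transpose).adjugate
  have h1 : ∀ x, ∑ c, blockCoeff e j s ω (x, c) * ω (x, c) = ∑ q : Fin m × Fin k,
      if j q.1 = x then D⁻¹ * (mat ω * R) x q * (if s q then 1 else -1) else 0 := by
    intro x
    by_cases hx : x ∈ Set.range e
    · have h2 : ∀ c, blockCoeff e j s ω (x, c) = 0 := fun c => by
        rw [blockCoeff]; simp only [if_pos hx]
      have h3 : ∀ l, j l ≠ x := fun l h => hj l (h ▸ hx)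
      simp [h2, h3]
    · have h2 : ∀ c, blockCoeff e j s ω (x, c) = D⁻¹ * R.mulVec
          (fun q => if j q.1 = x then (if s q then 1 else -1) else 0) c := fun c => by
        rw [blockCoeff]; simp only [if_neg hx]; rfl
      simp_rw [h2, Matrix.mulVec, dotProduct, Matrix.mul_apply, mat_apply, Finset.mul_sum,
        Finset.sum_mul]
      rw [Finset.sum_comm]
      refine Finset.sum_congr rfl fun q _ => ?_
      split_ifs <;> simp [mul_comm, mul_left_comm, mul_assoc]
  rw [dotProduct, Fintype.sum_prod_type]
  simp_rw [h1]
  rw [Finset.sum_comm]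
  refine Finset.sum_congr rfl fun q _ => ?_
  rw [Finset.sum_ite_eq]
  simp [R, Matrix.mul_assoc]

/-- Row x contributes at most r⁻¹ |σ x|², where σ x carries the signs of the blocks l with j l = x.
These supports partition the mk indices, so repeated rows cost nothing. -/
lemma blockCoeff_dotProduct_self_le {N d m k : ℕ} (e : Fin m × Fin k → Fin N) (j : Fin m → Fin N)
    (s : Fin m × Fin k → Bool) (ω : Fin N × Fin d → ℝ) {r : ℝ} (hr : 0 < r)
    (hA : ∀ u, r * (u ⬝ᵥ u) ≤ Matrix.vecMul u ((mat ω).submatrix e id) ⬝ᵥ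
      Matrix.vecMul u ((mat ω).submatrix e id)) :
    blockCoeff e j s ω ⬝ᵥ blockCoeff e j s ω ≤ r⁻¹ * (m * k) := by
  classical
  set A := (mat ω).submatrix e id
  let σ : Fin N → Fin m × Fin k → ℝ := fun x q => if j q.1 = x then (if s q then 1 else -1) else 0
  have h1 : ∀ x, ∑ c, blockCoeff e j s ω (x, c) * blockCoeff e j s ω (x, c) ≤
      r⁻¹ * (σ x ⬝ᵥ σ x) := by
    intro x
    by_cases hx : x ∈ Set.range e
    · have h2 : ∀ c, blockCoeff e j s ω (x, c) = 0 := fun c => by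
        rw [blockCoeff]; simp only [if_pos hx]
      simp only [h2, mul_zero, Finset.sum_const_zero]
      exact mul_nonneg (by positivity) (Finset.sum_nonneg fun i _ => mul_self_nonneg _)
    · have h2 : ∀ c, blockCoeff e j s ω (x, c) = ((A * A.transpose).det⁻¹ •
          (A.transpose * (A * A.transpose).adjugate).mulVec (σ x)) c := fun c => by
        rw [blockCoeff]; simp only [if_neg hx]; rfl
      simp_rw [h2]
      exact pinv_dotProduct_le A hr hA (σ x)
  rw [dotProduct, Fintype.sum_prod_type]
  refine (Finset.sum_le_sum fun x _ => h1 x).trans (le_of_eq ?_)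
  rw [← Finset.mul_sum]
  congr 1
  simp only [dotProduct]
  rw [Finset.sum_comm]
  have h3 : ∀ q : Fin m × Fin k, ∑ x, σ x q * σ x q = 1 := by
    intro q
    rw [Finset.sum_eq_single (j q.1)]
    · simp only [σ, if_true]
      split_ifs <;> norm_num
    · intro b _ hb
      simp [σ, hb.symm]
    · simp
  simp [h3]

/-- The failure probability of all `m` blocks of `k` rows. -/
theorem gaussian_notMem_biorthogonalSet_le {N d m k : ℕ} (hd : 0 < d) (hm : 0 < m)
    (hmk : 16 * (m * k) ≤ d)
    (e : Fin m × Fin k → Fin N) (he : Function.Injective e) :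
    (gaussian (Fin N × Fin d)).real {ω | mat ω ∉ biorthogonalSet e} ≤
      2 * Real.exp (5 * (m * k) - 3 / 4 * d) +
        (N : ℝ) ^ m * 2 ^ (m * k) * Real.exp (-(32 / 9) * m ^ 2) := by
  classical
  have hd' : (0 : ℝ) < d / 36 := by positivity
  let S : Set (Fin N × Fin d → ℝ) := {ω | ∀ u, (d : ℝ) / 36 * (u ⬝ᵥ u) ≤
    Matrix.vecMul u ((mat ω).submatrix e id) ⬝ᵥ Matrix.vecMul u ((mat ω).submatrix e id)}
  have hcA : Continuous fun ω : Fin N × Fin d → ℝ => (mat ω).submatrix e id :=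
    continuous_mat.matrix_submatrix _ _
  have hSm : MeasurableSet S := by
    refine IsClosed.measurableSet ?_
    simp only [S, Set.ofPred_forall]
    refine isClosed_iInter fun u => isClosed_le continuous_const ?_
    exact (continuous_const.matrix_vecMul hcA).dotProduct (continuous_const.matrix_vecMul hcA)
  have hS : (gaussian (Fin N × Fin d)).real Sᶜ ≤ 2 * Real.exp (5 * (m * k) - 3 / 4 * d) := by
    have h1 := gaussian_exists_small_vecMul_le (Fin m × Fin k) (Fin d)
    have hf : Function.Injective (Prod.map e id : (Fin m × Fin k) × Fin d → Fin N × Fin d) :=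
      he.prodMap Function.injective_id
    rw [← gaussian_map_comp _ hf, map_measureReal_apply (by fun_prop)] at h1
    · simp only [Fintype.card_prod, Fintype.card_fin, Nat.cast_mul] at h1
      exact h1
    · refine (IsClosed.measurableSet (s := {ω | ∀ u, _ ≤ _}) ?_).compl
      simp only [Set.ofPred_forall]
      refine isClosed_iInter fun u => isClosed_le continuous_const ?_
      exact (continuous_const.matrix_vecMul continuous_mat).dotProduct
        (continuous_const.matrix_vecMul continuous_mat)
  have hsub : {ω : Fin N × Fin d → ℝ | mat ω ∉ biorthogonalSet e} ⊆ Sᶜ ∪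
      ⋃ p ∈ (Finset.univ : Finset ((Fin m → Fin N) × (Fin m × Fin k → Bool))),
        {ω | ω ∈ S ∧ 4 * (m : ℝ) ≤ blockCoeff e p.1 p.2 ω ⬝ᵥ ω} := by
    intro ω hω
    by_cases hωS : ω ∈ S
    swap
    · exact Or.inl hωS
    right
    set A := (mat ω).submatrix e id
    have hD := det_mul_transpose_ne_zero A hd' hωS
    set D := (A * A.transpose).det
    set Q := mat ω * A.transpose * (A * A.transpose).adjugate
    have hω' : ∀ l, ∃ j, 4 * |D| ≤ ∑ i, |Q j (l, i)| := by
      intro l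
      by_contra! hcon
      exact hω ⟨l, hcon⟩
    choose j hj using hω'
    -- On a row used in A the block sum is at most |D| by biorthogonality, below 4|D|; hence every
    -- bad row is independent of A.
    have hjr : ∀ l, j l ∉ Set.range e := by
      rintro l ⟨q, hq⟩
      have h1 := hj l
      have h2 : ∀ i, Q (e q) (l, i) = D * (1 : Matrix _ _ ℝ) q (l, i) := fun i =>
        congrFun (congrFun (submatrix_mul_transpose_mul_adjugate e (mat ω)) q) (l, i)
      rw [← hq] at h1
      simp_rw [h2, abs_mul, ← Finset.mul_sum] at h1
      have h3 : ∑ i, |(1 : Matrix (Fin m × Fin k) (Fin m × Fin k) ℝ) q (l, i)| ≤ 1 := by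
        have : ∀ i, |(1 : Matrix (Fin m × Fin k) (Fin m × Fin k) ℝ) q (l, i)| ≤
            if q.2 = i then 1 else 0 := by
          intro i
          rw [Matrix.one_apply]
          by_cases h : q = (l, i)
          · simp [h]
          · simp only [h, if_false, abs_zero]
            split_ifs <;> norm_num
        refine (Finset.sum_le_sum fun i _ => this i).trans ?_
        simp
      have h4 := abs_pos.2 hD
      nlinarith
    let s : Fin m × Fin k → Bool := fun q => decide (0 ≤ D⁻¹ * Q (j q.1) q)
    simp only [Finset.mem_univ, Set.iUnion_true, Set.mem_iUnion]
    refine ⟨(j, s), hωS, ?_⟩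
    rw [blockCoeff_dotProduct e j hjr]
    have h5 : ∀ q : Fin m × Fin k, D⁻¹ * Q (j q.1) q * (if s q then 1 else -1) =
        |D|⁻¹ * |Q (j q.1) q| := by
      intro q
      rw [← abs_inv, ← abs_mul]
      by_cases h : 0 ≤ D⁻¹ * Q (j q.1) q
      · simp [s, h, abs_of_nonneg h]
      · simp [s, h, abs_of_neg (not_le.1 h)]
    change _ ≤ ∑ q, D⁻¹ * Q (j q.1) q * (if s q then 1 else -1)
    simp_rw [h5]
    rw [Fintype.sum_prod_type]
    have h6 : ∀ l : Fin m, (4 : ℝ) ≤ ∑ i, |D|⁻¹ * |Q (j l) (l, i)| := by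
      intro l
      rw [← Finset.mul_sum, ← div_eq_inv_mul, le_div_iff₀ (abs_pos.2 hD)]
      exact hj l
    calc 4 * (m : ℝ) = ∑ _l : Fin m, (4 : ℝ) := by simp [mul_comm]
      _ ≤ _ := Finset.sum_le_sum fun l _ => h6 l
  refine (measureReal_mono hsub (measure_ne_top _ _)).trans ((measureReal_union_le _ _).trans
    (add_le_add hS ((measureReal_biUnion_finset_le _ _).trans ?_)))
  have hone : ∀ p ∈ (Finset.univ : Finset ((Fin m → Fin N) × (Fin m × Fin k → Bool))),
      (gaussian (Fin N × Fin d)).real {ω | ω ∈ S ∧ 4 * (m : ℝ) ≤ blockCoeff e p.1 p.2 ω ⬝ᵥ ω} ≤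
        Real.exp (-(32 / 9) * m ^ 2) := by
    intro p _
    have hdep : ∀ ω ω' : Fin N × Fin d → ℝ, (∀ i, i.1 ∈ Set.range e → ω i = ω' i) →
        (mat ω).submatrix e id = (mat ω').submatrix e id := by
      intro ω ω' h
      ext q c
      exact h (e q, c) ⟨q, rfl⟩
    -- The variance bound is 36 mk / d ≤ 36/16 = 9/4.
    have h1 := gaussian_conditional_tail (fun i : Fin N × Fin d => i.1 ∈ Set.range e) S hSm
      (blockCoeff e p.1 p.2) ?_ ?_ ?_ (V := 9 / 4) (T := 4 * (m : ℝ)) (by norm_num) (by positivity)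
      ?_
    · refine h1.trans (Real.exp_le_exp.2 (le_of_eq ?_))
      ring
    · simp only [dotProduct]
      refine Finset.measurable_sum _ fun i _ => Measurable.mul ?_ (measurable_pi_apply i)
      simp only [blockCoeff]
      split_ifs
      · exact measurable_const
      · have hM := hcA.matrix_mul hcA.matrix_transpose
        refine (hM.matrix_det.measurable.inv).mul (Continuous.measurable ?_)
        exact (continuous_apply i.2).comp
          ((hcA.matrix_transpose.matrix_mul hM.matrix_adjugate).matrix_mulVec continuous_const)
    · intro ω i hi
      rw [blockCoeff]
      simp only [if_pos hi]
    · intro ω ω' h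
      have h2 := hdep ω ω' h
      refine ⟨by simp only [S, Set.mem_ofPred_eq, h2], ?_⟩
      ext i
      simp only [blockCoeff, h2]
    · intro ω hω
      refine (blockCoeff_dotProduct_self_le e p.1 p.2 ω hd' hω).trans ?_
      have h3 : (16 : ℝ) * (m * k) ≤ d := by exact_mod_cast hmk
      have h4 : (0 : ℝ) < d := by positivity
      rw [inv_div, div_mul_eq_mul_div, div_le_iff₀ h4]
      linarith
  refine (Finset.sum_le_sum hone).trans (le_of_eq ?_)
  simp

/-! ### Large N: Gaussian embeddings of Hilbert space -/

/-- The matrices `G` that are bounded below on a finite set `s`, whose rows are bounded by `b`, and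
whose rows are short on one of the blocks `e (l, ·)` of columns. -/
def shortBlockSet {N d m k : ℕ} (e : Fin m × Fin k → Fin d) (s : Finset (Fin d → ℝ)) (a b t : ℝ) :
    Set (Matrix (Fin N) (Fin d) ℝ) :=
  {G | (∀ v ∈ s, ∃ j, a < |G.mulVec v j|) ∧ (∀ j, G j ⬝ᵥ G j < b ^ 2) ∧
    ∃ l, ∀ j, ∑ i, G j (e (l, i)) ^ 2 < t}

lemma isOpen_shortBlockSet {N d m k : ℕ} (e : Fin m × Fin k → Fin d) (s : Finset (Fin d → ℝ))
    (a b t : ℝ) : IsOpen (shortBlockSet (N := N) e s a b t) := by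
  have hrow : ∀ j, Continuous fun G : Matrix (Fin N) (Fin d) ℝ => G j := fun j =>
    continuous_apply j
  have hent : ∀ j c, Continuous fun G : Matrix (Fin N) (Fin d) ℝ => G j c := fun j c =>
    continuous_id.matrix_elem j c
  refine IsOpen.inter ?_ (IsOpen.inter ?_ ?_)
  · change IsOpen {G : Matrix (Fin N) (Fin d) ℝ | ∀ v ∈ s, ∃ j, a < |G.mulVec v j|}
    simp only [Set.ofPred_forall, Set.ofPred_exists]
    refine s.finite_toSet.isOpen_biInter fun v _ => isOpen_iUnion fun j => ?_
    refine isOpen_lt continuous_const (Continuous.abs ?_)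
    exact (continuous_apply j).comp (continuous_id.matrix_mulVec continuous_const)
  · change IsOpen {G : Matrix (Fin N) (Fin d) ℝ | ∀ j, G j ⬝ᵥ G j < b ^ 2}
    simp only [Set.ofPred_forall]
    exact isOpen_iInter_of_finite fun j =>
      isOpen_lt ((hrow j).dotProduct (hrow j)) continuous_const
  · change IsOpen {G : Matrix (Fin N) (Fin d) ℝ | ∃ l, ∀ j, ∑ i, G j (e (l, i)) ^ 2 < t}
    simp only [Set.ofPred_forall, Set.ofPred_exists]
    exact isOpen_iUnion fun l => isOpen_iInter_of_finite fun j =>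
      isOpen_lt (continuous_finsetSum _ fun i _ => (hent j _).pow 2) continuous_const

/-- By Cauchy–Schwarz in each row, moving to a net point at distance δ changes every coordinate of G
u by at most δ b. -/
lemma le_norm_mulVec_of_mem_shortBlockSet {N d m k : ℕ} {e : Fin m × Fin k → Fin d}
    {s : Finset (Fin d → ℝ)} {a b t δ : ℝ} (hb : 0 ≤ b) (hδ : 0 ≤ δ)
    (hs : ∀ u : Fin d → ℝ, u ⬝ᵥ u = 1 → ∃ v ∈ s, (u - v) ⬝ᵥ (u - v) ≤ δ ^ 2)
    {G : Matrix (Fin N) (Fin d) ℝ} (hG : G ∈ shortBlockSet e s a b t) (x : Fin d → ℝ) :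
    (a - δ * b) * √(x ⬝ᵥ x) ≤ ‖G.mulVec x‖ := by
  have hunit : ∀ u : Fin d → ℝ, u ⬝ᵥ u = 1 → a - δ * b ≤ ‖G.mulVec u‖ := by
    intro u hu
    obtain ⟨v, hv, huv⟩ := hs u hu
    obtain ⟨j, hj⟩ := hG.1 v hv
    have h1 : |(G j) ⬝ᵥ (u - v)| ≤ δ * b := by
      refine abs_le_of_sq_le_sq' ?_ (by positivity) |> abs_le.2
      have h2 : (G j ⬝ᵥ (u - v)) ^ 2 ≤ (G j ⬝ᵥ G j) * ((u - v) ⬝ᵥ (u - v)) := by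
        have := Finset.sum_mul_sq_le_sq_mul_sq Finset.univ (G j) (u - v)
        simpa [dotProduct, sq] using this
      have h3 : 0 ≤ (u - v) ⬝ᵥ (u - v) := Finset.sum_nonneg fun i _ => mul_self_nonneg _
      calc _ ≤ _ := h2
        _ ≤ b ^ 2 * δ ^ 2 := mul_le_mul (hG.2.1 j).le huv h3 (by positivity)
        _ = (δ * b) ^ 2 := by ring
    have h4 : G.mulVec v j = G.mulVec u j - G j ⬝ᵥ (u - v) := by
      simp [Matrix.mulVec, dotProduct_sub]
    have h5 : |G.mulVec u j| ≤ ‖G.mulVec u‖ := norm_le_pi_norm (G.mulVec u) j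
    have h6 := abs_sub (G.mulVec u j) (G j ⬝ᵥ (u - v))
    rw [h4] at hj
    linarith
  by_cases hx : x = 0
  · simp [hx]
  · have hpos : 0 < x ⬝ᵥ x := lt_of_le_of_ne (Finset.sum_nonneg fun i _ => mul_self_nonneg _)
      fun h => hx (dotProduct_self_eq_zero.1 h.symm)
    have hsq := Real.sqrt_pos.2 hpos
    have h1 := hunit ((√(x ⬝ᵥ x))⁻¹ • x) (by
      rw [smul_dotProduct, dotProduct_smul, smul_eq_mul, smul_eq_mul, ← mul_assoc, ← mul_inv,
        Real.mul_self_sqrt hpos.le, inv_mul_cancel₀ hpos.ne'])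
    rw [Matrix.mulVec_smul, norm_smul, norm_inv, Real.norm_of_nonneg hsq.le, ← div_eq_inv_mul,
      le_div_iff₀ hsq] at h1
    exact h1

/-- The failure probability of the bounds that define `shortBlockSet`. -/
theorem gaussian_notMem_shortBlockSet_le {N d m k : ℕ} (e : Fin m × Fin k → Fin d)
    (he : Function.Injective e) (s : Finset (Fin d → ℝ)) (hs : ∀ v ∈ s, v ⬝ᵥ v = 1) {a b t : ℝ}
    (ha : 0 ≤ a) :
    (gaussian (Fin N × Fin d)).real {ω | mat ω ∉ shortBlockSet e s a b t} ≤
      s.card * Real.exp (-(N / 3 * Real.exp (-(a + 1) ^ 2 / 2))) +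
        N * Real.exp (7 / 20 * d - b ^ 2 / 4) +
        (N : ℝ) ^ m * Real.exp (7 / 20 * (m * k) - m * t / 4) := by
  classical
  have hsub : {ω : Fin N × Fin d → ℝ | mat ω ∉ shortBlockSet e s a b t} ⊆
      ((⋃ v ∈ s, (fun ω => (mat ω).mulVec v) ⁻¹' {x | ∀ j, |x j| ≤ a}) ∪
      (⋃ j ∈ (Finset.univ : Finset (Fin N)), (fun ω => ω ∘ fun c => (j, c)) ⁻¹'
        {x : Fin d → ℝ | b ^ 2 ≤ ∑ i, x i ^ 2})) ∪
      (⋃ j ∈ (Finset.univ : Finset (Fin m → Fin N)), (fun ω => ω ∘ fun q => (j q.1, e q)) ⁻¹'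
        {x : Fin m × Fin k → ℝ | m * t ≤ ∑ i, x i ^ 2}) := by
    intro ω hω
    by_contra hcon
    simp only [Set.mem_union, Set.mem_iUnion, Set.mem_preimage, Finset.mem_univ, exists_prop,
      true_and, Set.mem_ofPred_eq, not_or, not_exists, not_and, not_forall, not_le,
      Function.comp] at hcon
    obtain ⟨⟨h1, h2⟩, h3⟩ := hcon
    refine hω ⟨h1, fun j => ?_, ?_⟩
    · have := h2 j
      simpa [dotProduct, sq] using this
    · by_contra! h4
      choose j hj using h4
      have h5 := h3 j
      rw [Fintype.sum_prod_type] at h5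
      have h6 : (m : ℝ) * t ≤ ∑ l : Fin m, ∑ i, mat ω (j l) (e (l, i)) ^ 2 := by
        calc (m : ℝ) * t = ∑ _l : Fin m, t := by simp
          _ ≤ _ := Finset.sum_le_sum fun l _ => hj l
      exact absurd h6 (not_le.2 h5)
  refine (measureReal_mono hsub (measure_ne_top _ _)).trans ((measureReal_union_le _ _).trans
    (add_le_add ((measureReal_union_le _ _).trans (add_le_add ?_ ?_)) ?_))
  · refine (measureReal_biUnion_finset_le _ _).trans ((Finset.sum_le_card_nsmul _ _ _ fun v hv =>
      ?_).trans (le_of_eq (nsmul_eq_mul _ _)))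
    have hm : Measurable fun ω : Fin N × Fin d → ℝ => (mat ω).mulVec v :=
      (continuous_mat.matrix_mulVec continuous_const).measurable
    have hcl : MeasurableSet {x : Fin N → ℝ | ∀ j, |x j| ≤ a} := by
      simp only [Set.ofPred_forall]
      exact (isClosed_iInter fun j => isClosed_le (by fun_prop) continuous_const).measurableSet
    rw [← map_measureReal_apply hm hcl, gaussian_map_mat_mulVec v (hs v hv)]
    simpa using gaussian_forall_abs_le_le (Fin N) ha
  · refine (measureReal_biUnion_finset_le _ _).trans ((Finset.sum_le_card_nsmul _ _
      (Real.exp (7 / 20 * d - b ^ 2 / 4)) fun j _ =>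
      ?_).trans (le_of_eq ((nsmul_eq_mul _ _).trans (by simp))))
    rw [← map_measureReal_apply (by fun_prop) (measurableSet_le (by fun_prop) (by fun_prop)),
      gaussian_map_comp _ (Prod.mk_right_injective j)]
    simpa using gaussian_sum_sq_ge_le (Fin d) (b ^ 2)
  -- One bad row per block gives mk entries of G with sum of squares at least mt. They lie in
  -- distinct columns, hence are independent even if rows repeat.
  · refine (measureReal_biUnion_finset_le _ _).trans ((Finset.sum_le_card_nsmul _ _
      (Real.exp (7 / 20 * (m * k) - m * t / 4)) fun j _ =>
      ?_).trans (le_of_eq ((nsmul_eq_mul _ _).trans (by simp))))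
    rw [← map_measureReal_apply (by fun_prop) (measurableSet_le (by fun_prop) (by fun_prop)),
      gaussian_map_comp _ (fun q q' h => he (Prod.mk.inj h).2)]
    simpa using gaussian_sum_sq_ge_le (Fin m × Fin k) (m * t)

/-! ### Choice of parameters and conclusion -/

/-- The quotient `ℓ_1^N / E^⊥` contains a complemented `ℓ_1^k` or `ℓ_2^k`, and the subspace `E` of
`ℓ_∞^N` contains a complemented `ℓ_∞^k` or `ℓ_2^k`, for some `k ≥ m`. -/
def HasComplementedEll (C m : ℝ) {d N : ℕ} (E : Gr d N) : Prop :=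
  (ContainsComplementedEll 1 C m (QuotientOfEllOne E) ∨
    ContainsComplementedEll 2 C m (QuotientOfEllOne E)) ∧
  (ContainsComplementedEll ⊤ C m (SubspaceOfEllInfty E) ∨
    ContainsComplementedEll 2 C m (SubspaceOfEllInfty E))

lemma exists_injective_fin_prod {m k n : ℕ} (h : m * k ≤ n) :
    ∃ e : Fin m × Fin k → Fin n, Function.Injective e :=
  ⟨fun q => Fin.castLE h (finProdFinEquiv q),
    (Fin.castLE_injective h).comp finProdFinEquiv.injective⟩

/-- Absorbs the constant 3 into the exponent, since 7/16 - 1/4 = 3/16. -/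
lemma three_mul_exp_le {x y d : ℝ} (hd : 16 ≤ d) (hx : x ≤ Real.exp (-(7 / 16) * d))
    (hy : y ≤ 2 * Real.exp (-(7 / 16) * d)) : x + y ≤ Real.exp (-d / 4) := by
  have h1 : (3 : ℝ) ≤ Real.exp (3 / 16 * d) := by
    linarith [Real.add_one_le_exp (3 / 16 * d)]
  calc x + y ≤ 3 * Real.exp (-(7 / 16) * d) := by linarith
    _ ≤ Real.exp (3 / 16 * d) * Real.exp (-(7 / 16) * d) := by gcongr
    _ = Real.exp (-d / 4) := by rw [← Real.exp_add]; ring_nf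

/-- Small ambient dimension: `N ≤ e^s` with `s` about `√d`. -/
lemma exists_isOpen_of_le_exp {d N s k : ℕ} (h : d ≤ N) (hs : 16 ≤ s) (hsd : s * s ≤ d)
    (hds : d ≤ s * s + s + s) (hk : 16 * k ≤ s) (hN : (N : ℝ) ≤ Real.exp s) :
    ∃ S : Set (Matrix (Fin N) (Fin d) ℝ), IsOpen S ∧
      (∀ E : Gr d N, ∀ G ∈ S, LinearMap.range G.mulVecLin ≤ E.1 → HasComplementedEll 14 k E) ∧
      (gaussian (Fin N × Fin d)).real {ω | mat ω ∉ S} ≤ Real.exp (-d / 4) := by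
  have hskd : 16 * (s * k) ≤ d := by nlinarith
  obtain ⟨e, he⟩ := exists_injective_fin_prod (show s * k ≤ N by nlinarith)
  refine ⟨biorthogonalSet e, isOpen_biorthogonalSet e, ?_, ?_⟩
  · intro E G hG hGE
    obtain ⟨i, v, hv, hvi, hv4⟩ := exists_biorthogonal e hG
    have := containsComplementedEll_top_one E (C := 14) le_rfl (by norm_num) i v
      (fun l => hGE (hv l)) hvi fun j => (hv4 j).trans (by norm_num)
    exact ⟨Or.inl this.2, Or.inl this.1⟩
  · have hd : (256 : ℝ) ≤ d := by
      have : 256 ≤ d := by nlinarith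
      exact_mod_cast this
    have h1 := gaussian_notMem_biorthogonalSet_le (d := d) (by nlinarith) (by omega) hskd e he
    refine h1.trans ((add_comm _ _).trans_le (three_mul_exp_le (by linarith) ?_ ?_))
    · have hsR : (16 : ℝ) ≤ s := by exact_mod_cast hs
      have hkR : (16 : ℝ) * k ≤ s := by exact_mod_cast hk
      have hdR : (d : ℝ) ≤ s * s + s + s := by exact_mod_cast hds
      have h2 : (N : ℝ) ^ s ≤ Real.exp (s * s) := by
        rw [Real.exp_nat_mul]
        gcongr
      have h3 : (2 : ℝ) ^ (s * k) ≤ Real.exp ((s * k : ℕ) * (7 / 10)) := by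
        rw [Real.exp_nat_mul]
        exact pow_le_pow_left₀ (by norm_num) exp_seven_div_ten _
      calc _ ≤ Real.exp (s * s) * Real.exp ((s * k : ℕ) * (7 / 10)) *
            Real.exp (-(32 / 9) * s ^ 2) := by gcongr
        _ = Real.exp (s * s + (s * k : ℕ) * (7 / 10) + -(32 / 9) * s ^ 2) := by
            rw [Real.exp_add, Real.exp_add]
        _ ≤ _ := by
            refine Real.exp_le_exp.2 ?_
            push_cast
            nlinarith
    · refine mul_le_mul_of_nonneg_left (Real.exp_le_exp.2 ?_) zero_le_two
      have : (16 : ℝ) * (s * k) ≤ d := by exact_mod_cast hskd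
      linarith

/-- Large ambient dimension: `N = e^L` with `L > s`, where `s` is about `√d`. -/
lemma exists_isOpen_of_exp_lt {d N s k : ℕ} (hs : 16 ≤ s) (hsd : s * s ≤ d)
    (hds : d ≤ s * s + s + s) (hk : 16 * k ≤ s) {L : ℝ} (hL : s < L) (hN : (N : ℝ) = Real.exp L)
    (hlarge : 98 * L ^ 3 ≤ Real.exp (3 / 4 * L - 1) / 3) :
    ∃ S : Set (Matrix (Fin N) (Fin d) ℝ), IsOpen S ∧
      (∀ E : Gr d N, ∀ G ∈ S, LinearMap.range G.mulVecLin ≤ E.1 → HasComplementedEll 14 k E) ∧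
      (gaussian (Fin N × Fin d)).real {ω | mat ω ∉ S} ≤ Real.exp (-d / 4) := by
  have hskd : s * k ≤ d := by nlinarith
  obtain ⟨e, he⟩ := exists_injective_fin_prod hskd
  have hsR : (16 : ℝ) ≤ s := by exact_mod_cast hs
  have hkR : (16 : ℝ) * k ≤ s := by exact_mod_cast hk
  have hk0 : (0 : ℝ) ≤ k := by positivity
  have hdR : (d : ℝ) ≤ s * s + s + s := by exact_mod_cast hds
  have hdL : (d : ℝ) ≤ 2 * L ^ 2 := by nlinarith
  have hL16 : 16 ≤ L := by linarith
  have hd : (256 : ℝ) ≤ d := by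
    have : 256 ≤ d := by nlinarith
    exact_mod_cast this
  have hδ : 0 < 1 / (16 * L) := by positivity
  obtain ⟨net, hnet1, hnet2, hnet3⟩ := exists_net (Fin d) hδ
    ((div_le_one (by positivity)).2 (by linarith))
  have hsqrt : 4 ≤ √L := Real.le_sqrt_of_sq_le (by linarith)
  have hsq : √L ^ 2 = L := Real.sq_sqrt (by linarith)
  -- Row norm 4L and mesh 1/(16L) lose 1/4 from the lower bound √L / 2. Since √L ≥ 4, √(12L) / (√L/2
  -- - 1/4) ≤ 14.
  refine ⟨shortBlockSet e net (√L / 2) (4 * L) (12 * L), isOpen_shortBlockSet _ _ _ _ _, ?_, ?_⟩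
  · intro E G hG hGE
    obtain ⟨l, hl⟩ := hG.2.2
    have hα : 1 / (16 * L) * (4 * L) = 1 / 4 := by field_simp; norm_num
    have hlow := le_norm_mulVec_of_mem_shortBlockSet (by positivity) hδ.le hnet2 hG
    rw [hα] at hlow
    have h12 : √(12 * L) ≤ 7 / 2 * √L := by
      rw [Real.sqrt_le_left (by positivity), mul_pow, hsq]
      linarith
    have := containsComplementedEll_two E (C := 14) (m := k) (b := √(12 * L)) le_rfl
      (by linarith : 0 < √L / 2 - 1 / 4) (Real.sqrt_nonneg _) ?_ G hGE hlow
      (fun i => e (l, i)) (fun i i' h => (Prod.mk.inj (he h)).2) fun j => ?_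
    · exact ⟨Or.inr this.2, Or.inr this.1⟩
    · rw [div_le_iff₀ (by linarith)]
      linarith
    · rw [Real.sq_sqrt (by positivity)]
      exact (hl j).le
  · refine (gaussian_notMem_shortBlockSet_le e he net hnet1 (by positivity)).trans ?_
    have h0 : ∀ x : ℝ, x ≤ -d → Real.exp x ≤ Real.exp (-(7 / 16) * d) := fun x hx =>
      Real.exp_le_exp.2 (by linarith)
    have hpos := (Real.exp_pos (-(7 / 16) * (d : ℝ))).le
    rw [add_assoc]
    refine three_mul_exp_le (by linarith) ?_ ?_
    · have h1 : (net.card : ℝ) ≤ Real.exp (96 * L ^ 3) := by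
        refine hnet3.trans ?_
        have h2 : (3 / (1 / (16 * L)) : ℝ) = 48 * L := by field_simp; norm_num
        rw [Fintype.card_fin, h2]
        calc (48 * L) ^ d ≤ Real.exp (48 * L) ^ d := by
              gcongr
              linarith [Real.add_one_le_exp (48 * L)]
          _ = Real.exp (d * (48 * L)) := (Real.exp_nat_mul _ _).symm
          _ ≤ Real.exp (96 * L ^ 3) := by
              refine Real.exp_le_exp.2 ?_
              nlinarith
      -- Here (√L/2 + 1)² / 2 ≤ L/4 + 1.
      have h3 : Real.exp (3 / 4 * L - 1) / 3 ≤
          N / 3 * Real.exp (-(√L / 2 + 1) ^ 2 / 2) := by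
        rw [hN, div_mul_eq_mul_div _ _ (Real.exp (-(√L / 2 + 1) ^ 2 / 2)), ← Real.exp_add]
        gcongr
        nlinarith [sq_nonneg (√L / 2 - 1)]
      calc _ ≤ Real.exp (96 * L ^ 3) * Real.exp (-(98 * L ^ 3)) := by
            refine mul_le_mul h1 (Real.exp_le_exp.2 (neg_le_neg (hlarge.trans h3)))
              (Real.exp_nonneg _) (Real.exp_nonneg _)
        _ = Real.exp (-(2 * L ^ 3)) := by rw [← Real.exp_add]; ring_nf
        _ ≤ _ := h0 _ (by nlinarith [sq_nonneg L])
    · have h4 : (N : ℝ) * Real.exp (7 / 20 * d - (4 * L) ^ 2 / 4) ≤ Real.exp (-(7 / 16) * d) := by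
        rw [hN, ← Real.exp_add]
        exact h0 _ (by nlinarith)
      have h5 : (N : ℝ) ^ s * Real.exp (7 / 20 * (s * k) - s * (12 * L) / 4) ≤
          Real.exp (-(7 / 16) * d) := by
        rw [hN, ← Real.exp_nat_mul, ← Real.exp_add]
        refine h0 _ ?_
        have h6 : (s : ℝ) * k ≤ s * L / 16 := by nlinarith
        have h7 : (s : ℝ) * s ≤ s * L := by nlinarith
        nlinarith
      linarith

/-- In the bound 98 L³, the part 96 L³ pays for the net and 2 L³ ≥ d remains for the probability. -/
lemma exists_forall_cube_le_exp : ∃ L₀ : ℕ, ∀ L : ℝ, L₀ ≤ L →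
    98 * L ^ 3 ≤ Real.exp (3 / 4 * L - 1) / 3 := by
  have h1 := (Real.tendsto_pow_mul_exp_neg_atTop_nhds_zero 3).eventually
    (gt_mem_nhds (show (0 : ℝ) < 1 / 2200 by norm_num))
  obtain ⟨x₀, hx₀⟩ := Filter.eventually_atTop.1 h1
  refine ⟨⌈2 * |x₀|⌉₊, fun L hL => ?_⟩
  have h2 : 2 * |x₀| ≤ L := (Nat.le_ceil _).trans hL
  have h3 : x₀ ≤ 3 / 4 * L := by
    have := le_abs_self x₀
    have := abs_nonneg x₀
    linarith
  have h4 := hx₀ _ h3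
  rw [Real.exp_neg, ← div_eq_mul_inv, div_lt_iff₀ (Real.exp_pos _)] at h4
  rw [Real.exp_sub, div_div, le_div_iff₀ (by positivity)]
  have h5 : Real.exp 1 ≤ 2.7183 := by linarith [Real.exp_one_lt_d9]
  have hL0 : 0 ≤ L ^ 3 := by
    have := abs_nonneg x₀
    have : 0 ≤ L := by linarith
    positivity
  nlinarith

/-- One-dimensional subspaces are complemented. -/
lemma hasComplementedEll_of_le_one {d N : ℕ} (hd : 0 < d) (E : Gr d N) {C m : ℝ} (hC : 1 ≤ C)
    (hm : m ≤ 1) : HasComplementedEll C m E := by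
  have hne : E.1 ≠ ⊥ := by
    intro h
    have := E.2
    rw [h, finrank_bot] at this
    omega
  obtain ⟨x, hx, hx0⟩ := Submodule.exists_mem_ne_zero_of_ne_bot hne
  obtain ⟨j₀, hj₀⟩ := Function.ne_iff.1 hx0
  have : Nonempty (Fin N) := ⟨j₀⟩
  -- Normalizing at a coordinate of largest modulus bounds all coordinates by 1.
  obtain ⟨j, hj⟩ := Finite.exists_max fun i => |x i|
  have hj0 : 0 < |x j| := (abs_pos.2 hj₀).trans_le (hj j₀)
  have := containsComplementedEll_top_one (k := 1) E (C := C) (m := m) (by simpa using hm)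
    (by linarith) (fun _ => j) (fun _ => (x j)⁻¹ • x) (fun _ => E.1.smul_mem _ hx)
    (fun l l' => by
      simp [Subsingleton.elim l l', inv_mul_cancel₀ (abs_pos.1 hj0)])
    (fun i => by
      simp only [Finset.univ_unique, Finset.sum_singleton, Pi.smul_apply, smul_eq_mul, abs_mul,
        abs_inv]
      rw [← div_eq_inv_mul]
      exact ((div_le_one hj0).2 (hj i)).trans hC)
  exact ⟨Or.inl this.2, Or.inl this.1⟩

lemma ContainsComplementedEll.mono {p : ENNReal} [Fact (1 ≤ p)] {C m m' : ℝ} (h : m' ≤ m)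
    {X : Type*} [SeminormedAddCommGroup X] [NormedSpace ℝ X]
    (hX : ContainsComplementedEll p C m X) : ContainsComplementedEll p C m' X := by
  obtain ⟨k, F, hk, hF⟩ := hX
  exact ⟨k, F, h.trans hk, hF⟩

lemma HasComplementedEll.mono {C m m' : ℝ} (h : m' ≤ m) {d N : ℕ} {E : Gr d N}
    (hE : HasComplementedEll C m E) : HasComplementedEll C m' E :=
  ⟨hE.1.imp (.mono h) (.mono h), hE.2.imp (.mono h) (.mono h)⟩

/-- Outside a set of exponentially small measure, the subspace and the quotient contain
complemented copies of `ℓ_∞^k`, `ℓ_1^k` or `ℓ_2^k`. -/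
theorem exists_grassmannHaar_not_hasComplementedEll_le : ∃ c : ℝ, 0 < c ∧
    ∀ (d N : ℕ) (h : d ≤ N), grassmannHaar h {E | ¬ HasComplementedEll 14 (c * √d) E} ≤
      ENNReal.ofReal (Real.exp (-1 / 4) ^ d) := by
  obtain ⟨L₀, hL₀⟩ := exists_forall_cube_le_exp
  set s₀ := max 16 L₀
  have hs₀ : (0 : ℝ) < s₀ := by
    have : 0 < s₀ := by omega
    exact_mod_cast this
  -- The factor 1/s₀ gives c √d ≤ 1 when d < s₀², where a single line suffices. Otherwise √d ≤ 2s ≤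
  -- 64 ⌊s/16⌋ explains 1/64.
  refine ⟨min (1 / 64) (1 / s₀), by positivity, fun d N h => ?_⟩
  set c : ℝ := min (1 / 64) (1 / s₀)
  rcases Nat.eq_zero_or_pos d with rfl | hd
  · simpa using prob_le_one
  rcases lt_or_ge d (s₀ * s₀) with hsmall | hlarge
  · have hm : c * √d ≤ 1 := by
      have h1 : √(d : ℝ) ≤ s₀ := by
        rw [Real.sqrt_le_left hs₀.le, sq]
        exact_mod_cast hsmall.le
      calc c * √d ≤ 1 / s₀ * s₀ := by
            gcongr
            exact min_le_right _ _
        _ = 1 := by field_simp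
    have : {E : Gr d N | ¬ HasComplementedEll 14 (c * √d) E} = ∅ := by
      ext E
      simpa using hasComplementedEll_of_le_one hd E (by norm_num) hm
    rw [this, measure_empty]
    exact zero_le
  · set s := Nat.sqrt d
    have hs₀s : s₀ ≤ s := Nat.le_sqrt.2 hlarge
    have hs : 16 ≤ s := by omega
    have hsd : s * s ≤ d := Nat.sqrt_le d
    have hds : d ≤ s * s + s + s := Nat.sqrt_le_add d
    have hk : 16 * (s / 16) ≤ s := Nat.mul_div_le s 16
    have hck : c * √d ≤ (s / 16 : ℕ) := by
      have h1 : √(d : ℝ) ≤ 2 * s := by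
        rw [Real.sqrt_le_left (by positivity)]
        have : d ≤ (2 * s) ^ 2 := by nlinarith
        exact_mod_cast this
      have h2 : s ≤ 32 * (s / 16) := by omega
      have h3 : (s : ℝ) ≤ 32 * (s / 16 : ℕ) := by exact_mod_cast h2
      calc c * √d ≤ 1 / 64 * (2 * s) := by
            gcongr
            exact min_le_left _ _
        _ ≤ _ := by linarith
    obtain ⟨S, hSo, hS, hSp⟩ : ∃ S : Set (Matrix (Fin N) (Fin d) ℝ), IsOpen S ∧
        (∀ E : Gr d N, ∀ G ∈ S, LinearMap.range G.mulVecLin ≤ E.1 →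
          HasComplementedEll 14 (s / 16 : ℕ) E) ∧
        (gaussian (Fin N × Fin d)).real {ω | mat ω ∉ S} ≤ Real.exp (-d / 4) := by
      rcases le_or_gt (N : ℝ) (Real.exp s) with hN | hN
      · exact exists_isOpen_of_le_exp h hs hsd hds hk hN
      · have hN0 : (0 : ℝ) < N := (Real.exp_pos _).trans hN
        have hL : s < Real.log N := (Real.lt_log_iff_exp_lt hN0).2 hN
        refine exists_isOpen_of_exp_lt hs hsd hds hk hL (Real.exp_log hN0).symm (hL₀ _ ?_)
        have : (L₀ : ℝ) ≤ s := by
          have : L₀ ≤ s := by omega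
          exact_mod_cast this
        linarith
    refine (grassmannHaar_le_gaussian h _ S hSo ?_).trans ?_
    · intro E hE G hG hGE
      exact hE ((hS E G hG hGE).mono hck)
    · rw [← Real.exp_nat_mul, show (d : ℝ) * (-1 / 4) = -d / 4 by ring]
      exact (ENNReal.le_ofReal_iff_toReal_le (measure_ne_top _ _) (Real.exp_nonneg _)).2 hSp

end GenericSubspaces
end

theorem corollary4p4 :
    ∃ C c ε : ℝ, 0 < C ∧ 0 < c ∧ 0 < ε ∧ ε < 1 ∧
      ∀ (d N : ℕ) (h : d ≤ N),
        (GenericSubspaces.grassmannHaar h)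
            {E | ¬ (GenericSubspaces.ContainsComplementedEll 1 C (c * Real.sqrt d)
                      (GenericSubspaces.QuotientOfEllOne E) ∨
                    GenericSubspaces.ContainsComplementedEll 2 C (c * Real.sqrt d)
                      (GenericSubspaces.QuotientOfEllOne E))}
          ≤ ENNReal.ofReal (ε ^ d) ∧
        (GenericSubspaces.grassmannHaar h)
            {E | ¬ (GenericSubspaces.ContainsComplementedEll ⊤ C (c * Real.sqrt d)
                      (GenericSubspaces.SubspaceOfEllInfty E) ∨
                    GenericSubspaces.ContainsComplementedEll 2 C (c * Real.sqrt d)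
                      (GenericSubspaces.SubspaceOfEllInfty E))}
          ≤ ENNReal.ofReal (ε ^ d) := by
  obtain ⟨c, hc, h⟩ := GenericSubspaces.exists_grassmannHaar_not_hasComplementedEll_le
  refine ⟨14, c, Real.exp (-1 / 4), by norm_num, hc, Real.exp_pos _,
    Real.exp_lt_one_iff.2 (by norm_num), fun d N hdN => ⟨?_, ?_⟩⟩
  · refine le_trans (measure_mono ?_) (h d N hdN)
    exact fun E hE hE' => hE hE'.1
  · refine le_trans (measure_mono ?_) (h d N hdN)
    exact fun E hE hE' => hE hE'.2
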